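/- **Setting.** Let $H,K,U$ be separable real Hilbert spaces and $T>0$. Write $\Sigma(\cdot)$ (resp. $\Sigma^+(\cdot)$) for the bounded self-adjoint (resp. self-adjoint nonnegative) operators, and $C_s([0,T];\Sigma^+(H))$ for the strongly continuous maps $[0,T]\to\Sigma^+(H)$. Let $A:D(A)\subset H\to H$ be a closed densely defined operator generating a $C_0$-semigroup $(e^{tA})_{t\ge 0}$, with $e^{tA^*}=(e^{tA})^*$; let $B\in\mathcal L(U;H)$, $\sigma\in\mathcal L(K;H)$, $S,S_T\in\mathcal L(H)$, $Q,Q_T\in\Sigma^+(H)$, $\overline Q,\overline Q_T\in\Sigma(H)$ with $Q+\overline Q,\ Q_T+\overline Q_T\in\Sigma^+(H)$, and $R\in\Sigma(U)$ with $\langle R\alpha,\alpha\rangle\ge\varepsilon|\alpha|^2$ for all $\alpha\in U$ and some $\varepsilon>0$. Let $m_0$ be a Borel probability measure on $H$ with finite first moment and $z_0=\int_H x\,m_0(dx)$. A map $P\in C_s([0,T];\Sigma^+(H))$ is a *mild solution of the Riccati equation* if for all $x\in H$, $t\in[0,T]$ $$P(t)x=e^{(T-t)A^*}(Q_T+\overline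 Q_T)e^{(T-t)A}x+\int_t^T e^{(s-t)A^*}(Q+\overline Q)e^{(s-t)A}x\,ds-\int_t^T e^{(s-t)A^*}P(s)BR^{-1}B^*P(s)e^{(s-t)A}x\,ds.$$ A *Linear-Quadratic-Mean (LQM) mild solution* of the mean field game is a quadruple $(P,r,z,s)$ with $P\in C_s([0,T];\Sigma^+(H))$, $r,z\in C([0,T];H)$, $s\in C([0,T];\mathbb R)$ such that $P$ is a mild solution of the Riccati equation and, for all $t\in[0,T]$, $$z(t)=e^{tA}z_0-\int_0^t e^{(t-s)A}BR^{-1}B^*P(s)z(s)\,ds-\int_0^t e^{(t-s)A}BR^{-1}B^*r(s)\,ds,$$ $$r(t)=-e^{(T-t)A^*}\overline Q_TS_Tz(T)-\int_t^T e^{(s-t)A^*}P(s)BR^{-1}B^*r(s)\,ds-\int_t^T e^{(s-t)A^*}\overline QSz(s)\,ds,$$ $$s(t)=\tfrac12\langle\overline Q_TS_Tz(T),S_Tz(T)\rangle+\int_t^T\Big[\tfrac12\mathrm{Tr}[\sigma\sigma^*P(u)]-\tfrac12\langle BR^{-1}B^*r(u),r(u)\rangle+\tfrac12\langle\overline QSz(u),Sz(u)\rangle\Big]du,$$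 where the last formula includes that $\sigma\sigma^*P(u)$ is trace class for a.e. $u\in[0,T]$ and $u\mapsto\mathrm{Tr}[\sigma\sigma^*P(u)]$ is integrable on $[0,T]$. **Theorem (Existence).** For all large $n\in\mathbb N$ let $A_n=n^2(n-A)^{-1}-nI\in\mathcal L(H)$ be the Yosida approximations of $A$. Assume that the mild solution $P$ of the Riccati equation has the following properties. * (H1) For all sufficiently large $n$ there is $\eta_n:[0,T]\to\Sigma(H)$ with $\eta_n(T)=-\overline Q_TS_T$ such that, for all $x\in H$, $t\mapsto\eta_n(t)x$ is differentiable on $[0,T]$ and, for all $t\in[0,T]$, $$\tfrac{d}{dt}\eta_n(t)x=(P(t)BR^{-1}B^*-A_n^*)\eta_n(t)x-\eta_n(t)(A_n-BR^{-1}B^*P(t))x+\overline QSx+\eta_n(t)BR^{-1}B^*\eta_n(t)x.$$ * (H2) These $\eta_n$ are bounded uniformly: $\sup_{n,\,t\in[0,T]}\|\eta_n(t)\|_{\mathcal L(H)}<\infty$, the supremum being over those large $n$. * (Trace) $\sigma\sigma^*P(t)$ is trace class for a.e. $t\in[0,T]$ and $t\mapsto\mathrm{Tr}[\sigma\sigma^*P(t)]$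 is integrable on $[0,T]$ (for instance, $\sigma$ is Hilbert–Schmidt). Then there exists an LQM mild solution $(P,r,z,s)$ of the mean field game. (The existence of the mild solution $P$ of the Riccati equation is part of the claim.) -/

import Mathlib

open Set Filter Topology MeasureTheory

namespace LQMFG

section General

variable {H : Type*} [NormedAddCommGroup H] [InnerProductSpace ℝ H]

/-- `E` is a `C₀`-semigroup of bounded operators (only its values on `[0, ∞)` matter). -/
structure IsC0Semigroup (E : ℝ → H →L[ℝ] H) : Prop where
  zero : E 0 = ContinuousLinearMap.id ℝ H
  add : ∀ s t : ℝ, 0 ≤ s → 0 ≤ t → E (s + t) = (E s).comp (E t)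
  tendsto_zero : ∀ x : H, Tendsto (fun t => E t x) (𝓝[>] 0) (𝓝 x)

/-- `A` (with its domain) is the infinitesimal generator of `E`. -/
def IsGenerator (A : H →ₗ.[ℝ] H) (E : ℝ → H →L[ℝ] H) : Prop :=
  ∀ x y : H, (x, y) ∈ A.graph ↔ Tendsto (fun h : ℝ => h⁻¹ • (E h x - x)) (𝓝[>] 0) (𝓝 y)

/-- `J` is a bounded two-sided inverse of `l - A : D(A) → H`. -/
def IsResolvent (A : H →ₗ.[ℝ] H) (l : ℝ) (J : H →L[ℝ] H) : Prop :=
  (∀ y : H, ∃ x : A.domain, (x : H) = J y ∧ l • (x : H) - A x = y) ∧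
    ∀ x : A.domain, J (l • (x : H) - A x) = x

open Classical in
/-- The resolvent operator `R(l, A) = (l - A)⁻¹`; by convention `0` if `l` is not in the
resolvent set. -/
noncomputable def resolventOp (A : H →ₗ.[ℝ] H) (l : ℝ) : H →L[ℝ] H :=
  if h : ∃ J : H →L[ℝ] H, IsResolvent A l J then h.choose else 0

/-- The Yosida approximation `A_n = n² R(n, A) - n I`. -/
noncomputable def yosida (A : H →ₗ.[ℝ] H) (n : ℕ) : H →L[ℝ] H :=
  ((n : ℝ) ^ 2) • resolventOp A (n : ℝ) - (n : ℝ) • ContinuousLinearMap.id ℝ H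

/-- `F` belongs to `C_s([0,T]; Σ⁺(H))`. -/
structure IsStronglyContPos (T : ℝ) (F : ℝ → H →L[ℝ] H) : Prop where
  isPositive : ∀ t ∈ Icc 0 T, (F t).IsPositive
  continuousOn : ∀ x : H, ContinuousOn (fun t => F t x) (Icc 0 T)

/-- Hilbert–Schmidt operators. -/
def IsHilbertSchmidt (L : H →L[ℝ] H) : Prop :=
  ∀ (w : Set H) (b : HilbertBasis w ℝ H), Summable fun i => ‖L (b i)‖ ^ 2

/-- Trace class operators: products of two Hilbert–Schmidt operators. -/
def IsTraceClass (L : H →L[ℝ] H) : Prop :=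
  ∃ L₁ L₂ : H →L[ℝ] H, IsHilbertSchmidt L₁ ∧ IsHilbertSchmidt L₂ ∧ L = L₁.comp L₂

/-- The trace `∑ₖ ⟨eₖ, L eₖ⟩` in an orthonormal basis of `H` (for trace class `L` the value does
not depend on the basis). -/
noncomputable def operatorTrace [CompleteSpace H] (L : H →L[ℝ] H) : ℝ :=
  ∑' i : (exists_hilbertBasis ℝ H).choose,
    inner ℝ ((exists_hilbertBasis ℝ H).choose_spec.choose i)
      (L ((exists_hilbertBasis ℝ H).choose_spec.choose i))

end General

section Game

variable (H K U : Type*)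
  [NormedAddCommGroup H] [InnerProductSpace ℝ H] [CompleteSpace H]
  [NormedAddCommGroup K] [InnerProductSpace ℝ K] [CompleteSpace K]
  [NormedAddCommGroup U] [InnerProductSpace ℝ U] [CompleteSpace U]

/-- The coefficients of the linear-quadratic mean field game; `expA t` stands for `e^{tA}`. -/
structure Coefficients where
  A : H →ₗ.[ℝ] H
  expA : ℝ → H →L[ℝ] H
  B : U →L[ℝ] H
  Q : H →L[ℝ] H
  QT : H →L[ℝ] H
  Qbar : H →L[ℝ] H
  QbarT : H →L[ℝ] H
  R : U →L[ℝ] U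
  S : H →L[ℝ] H
  ST : H →L[ℝ] H
  σ : K →L[ℝ] H

variable {H K U}

namespace Coefficients

/-- The standing assumptions on the coefficients. -/
structure Standing (D : Coefficients H K U) : Prop where
  dense_domain : Dense (D.A.domain : Set H)
  closed : D.A.IsClosed
  semigroup : IsC0Semigroup D.expA
  generator : IsGenerator D.A D.expA
  Q_pos : D.Q.IsPositive
  QT_pos : D.QT.IsPositive
  Qbar_selfAdjoint : IsSelfAdjoint D.Qbar
  QbarT_selfAdjoint : IsSelfAdjoint D.QbarT
  Q_add_Qbar_pos : (D.Q + D.Qbar).IsPositive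
  QT_add_QbarT_pos : (D.QT + D.QbarT).IsPositive
  R_selfAdjoint : IsSelfAdjoint D.R
  R_coercive : ∃ ε > 0, ∀ α : U, ε * ‖α‖ ^ 2 ≤ inner ℝ (D.R α) α

/-- `e^{tA*}`, the adjoint of `e^{tA}`. -/
noncomputable def expAdj (D : Coefficients H K U) (t : ℝ) : H →L[ℝ] H :=
  ContinuousLinearMap.adjoint (D.expA t)

/-- `B R⁻¹ B*`. -/
noncomputable def BRB (D : Coefficients H K U) : H →L[ℝ] H :=
  D.B ∘L D.R.inverse ∘L ContinuousLinearMap.adjoint D.B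

/-- `σ σ* P`. -/
noncomputable def diffusionOp (D : Coefficients H K U) (P : H →L[ℝ] H) : H →L[ℝ] H :=
  D.σ ∘L ContinuousLinearMap.adjoint D.σ ∘L P

/-- `P ∈ C_s([0,T]; Σ⁺(H))` is a mild solution of the backward Riccati equation
`P' + P A + A* P - P B R⁻¹ B* P + Q + Q̄ = 0`, `P(T) = Q_T + Q̄_T`. -/
def IsMildRiccati (D : Coefficients H K U) (T : ℝ) (P : ℝ → H →L[ℝ] H) : Prop :=
  IsStronglyContPos T P ∧
    ∀ x : H, ∀ t ∈ Icc 0 T,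
      P t x = D.expAdj (T - t) ((D.QT + D.QbarT) (D.expA (T - t) x))
        + (∫ s in t..T, D.expAdj (s - t) ((D.Q + D.Qbar) (D.expA (s - t) x)))
        - ∫ s in t..T, D.expAdj (s - t) (P s (D.BRB (P s (D.expA (s - t) x))))

/-- `(z, r) ∈ C([0,T]; H²)` is a mild solution of the forward-backward system
`z' = (A - B R⁻¹ B* P) z - B R⁻¹ B* r`, `z(0) = z₀`,
`r' + (A* - P B R⁻¹ B*) r - Q̄ S z = 0`, `r(T) = - Q̄_T S_T z(T)`. -/
structure IsMildForwardBackward (D : Coefficients H K U) (T : ℝ) (z₀ : H)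
    (P : ℝ → H →L[ℝ] H) (z r : ℝ → H) : Prop where
  continuousOn_z : ContinuousOn z (Icc 0 T)
  continuousOn_r : ContinuousOn r (Icc 0 T)
  z_eq : ∀ t ∈ Icc 0 T,
    z t = D.expA t z₀ - (∫ s in (0 : ℝ)..t, D.expA (t - s) (D.BRB (P s (z s))))
      - ∫ s in (0 : ℝ)..t, D.expA (t - s) (D.BRB (r s))
  r_eq : ∀ t ∈ Icc 0 T,
    r t = D.expAdj (T - t) (-(D.QbarT (D.ST (z T))))
      - (∫ s in t..T, D.expAdj (s - t) (P s (D.BRB (r s))))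
      - ∫ s in t..T, D.expAdj (s - t) (D.Qbar (D.S (z s)))

/-- `Tr[σ σ* P(t)]` makes sense for almost every `t ∈ [0,T]` and is integrable on `[0,T]`. -/
def HasIntegrableTrace (D : Coefficients H K U) (T : ℝ) (P : ℝ → H →L[ℝ] H) : Prop :=
  (∀ᵐ t ∂(volume.restrict (Icc 0 T)), IsTraceClass (D.diffusionOp (P t))) ∧
    IntegrableOn (fun t => operatorTrace (D.diffusionOp (P t))) (Icc 0 T)

/-- The LQM (linear-quadratic-mean) mild solutions of the mean field game with initial mean `z₀`. -/
structure IsLQMMildSolution (D : Coefficients H K U) (T : ℝ) (z₀ : H)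
    (P : ℝ → H →L[ℝ] H) (r z : ℝ → H) (s : ℝ → ℝ) : Prop where
  riccati : D.IsMildRiccati T P
  forwardBackward : D.IsMildForwardBackward T z₀ P z r
  integrableTrace : D.HasIntegrableTrace T P
  continuousOn_s : ContinuousOn s (Icc 0 T)
  s_eq : ∀ t ∈ Icc 0 T,
    s t = (1 / 2 : ℝ) * inner ℝ (D.QbarT (D.ST (z T))) (D.ST (z T))
      + ∫ u in t..T, ((1 / 2 : ℝ) * operatorTrace (D.diffusionOp (P u))
          - (1 / 2 : ℝ) * inner ℝ (D.BRB (r u)) (r u)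
          + (1 / 2 : ℝ) * inner ℝ (D.Qbar (D.S (z u))) (D.S (z u)))

/-- `η : [0,T] → Σ(H)` is a strict solution of the Riccati equation
`η' = (P B R⁻¹ B* - A_n*) η - η (A_n - B R⁻¹ B* P) + Q̄ S + η B R⁻¹ B* η`,
`η(T) = - Q̄_T S_T`, with a bounded operator `An` in place of `A_n`. At the end points of `[0,T]`
the derivative is one-sided. -/
structure IsStrictRiccati (D : Coefficients H K U) (T : ℝ) (P : ℝ → H →L[ℝ] H)
    (An : H →L[ℝ] H) (η : ℝ → H →L[ℝ] H) : Prop where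
  selfAdjoint : ∀ t ∈ Icc 0 T, IsSelfAdjoint (η t)
  terminal : η T = -(D.QbarT ∘L D.ST)
  hasDeriv : ∀ t ∈ Icc 0 T, ∀ x : H,
    HasDerivWithinAt (fun u => η u x)
      ((P t (D.BRB (η t x)) - ContinuousLinearMap.adjoint An (η t x))
        - η t (An x - D.BRB (P t x))
        + D.Qbar (D.S x) + η t (D.BRB (η t x)))
      (Icc 0 T) t

/-- For all sufficiently large `n` the Riccati equation with the Yosida approximation `A_n` of `A`
has a strict solution `η_n`, and `‖η_n(t)‖` is bounded uniformly in `n` and `t ∈ [0,T]`. -/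
def YosidaRiccatiSolvable (D : Coefficients H K U) (T : ℝ) (P : ℝ → H →L[ℝ] H) : Prop :=
  ∃ (N : ℕ) (C : ℝ), ∀ n ≥ N, ∃ η : ℝ → H →L[ℝ] H,
    D.IsStrictRiccati T P (yosida D.A n) η ∧ ∀ t ∈ Icc 0 T, ‖η t‖ ≤ C

end Coefficients

end Game

end LQMFG

/-!
The Riccati equation is solved by Picard iteration in an exponentially weighted norm. Moving a large
multiple `λ P` from the generator to the source turns `Q - P K P` into `Q - P K P + λ P`, which is
nonnegative for `0 ≤ P ≤ V`, `V` being the Lyapunov solution; the iteration therefore preserves this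
order interval.

For the bounded generator `A_n` the ansatz `r = η_n z` decouples the forward-backward system into a
linear equation for `z`, and (H2) with Grönwall's inequality bounds `z_n` and `r_n` uniformly. A
subsequence converges weakly in `L²(0, T; H)`. Since `e^{tA_n}` and `e^{tA_n*}` converge strongly,
the right-hand sides of the mild equations converge weakly at every time, hence so do `z_n` and
`r_n`. These pointwise limits are continuous and agree almost everywhere with the `L²` limits, so
they solve the limiting equations. Finally, `s` is given by an explicit formula.
-/

namespace LQMFG

open scoped InnerProduct

section StrongContinuity

variable {α X Y Z : Type*} [TopologicalSpace α]
  [NormedAddCommGroup X] [NormedSpace ℝ X] [NormedAddCommGroup Y] [NormedSpace ℝ Y]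
  [NormedAddCommGroup Z] [NormedSpace ℝ Z]

/-- Continuity of a family of bounded operators in the strong operator topology. -/
def StronglyContinuous (F : α → X →L[ℝ] Y) : Prop :=
  ∀ x, Continuous fun a => F a x

namespace StronglyContinuous

variable {F F' : α → X →L[ℝ] Y}

lemma const (L : X →L[ℝ] Y) : StronglyContinuous fun _ : α => L :=
  fun _ => continuous_const

lemma add (hF : StronglyContinuous F) (hF' : StronglyContinuous F') :
    StronglyContinuous fun a => F a + F' a :=
  fun x => (hF x).add (hF' x)

lemma sub (hF : StronglyContinuous F) (hF' : StronglyContinuous F') :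
    StronglyContinuous fun a => F a - F' a :=
  fun x => (hF x).sub (hF' x)

lemma smul {c : α → ℝ} (hc : Continuous c) (hF : StronglyContinuous F) :
    StronglyContinuous fun a => c a • F a :=
  fun x => hc.smul (hF x)

lemma comp_continuous {β : Type*} [TopologicalSpace β] {τ : β → α} (hF : StronglyContinuous F)
    (hτ : Continuous τ) : StronglyContinuous fun b => F (τ b) :=
  fun x => (hF x).comp hτ

variable [CompleteSpace X]

lemma exists_norm_le (hF : StronglyContinuous F) {K : Set α} (hK : IsCompact K) :
    ∃ C, 0 < C ∧ ∀ a ∈ K, ‖F a‖ ≤ C := by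
  have pointwise : ∀ x, ∃ C, ∀ a : K, ‖F a x‖ ≤ C := fun x =>
    (hK.exists_bound_of_continuousOn (hF x).continuousOn).imp fun C hC a => hC a a.2
  obtain ⟨C, hC⟩ := banach_steinhaus pointwise
  exact ⟨max C 1, by positivity, fun a ha => (hC ⟨a, ha⟩).trans (le_max_left _ _)⟩

lemma continuous_uncurry [WeaklyLocallyCompactSpace α] (hF : StronglyContinuous F) :
    Continuous fun p : α × X => F p.1 p.2 := by
  rw [continuous_iff_continuousAt]
  rintro ⟨a, x⟩
  obtain ⟨K, hK, haK⟩ := exists_compact_mem_nhds a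
  obtain ⟨C, -, hC⟩ := hF.exists_norm_le hK
  have bound_tendsto : Tendsto (fun p : α × X => C * ‖p.2 - x‖ + ‖F p.1 x - F a x‖)
      (𝓝 (a, x)) (𝓝 0) := by
    have : Continuous fun p : α × X => C * ‖p.2 - x‖ + ‖F p.1 x - F a x‖ :=
      (continuous_const.mul (continuous_snd.sub continuous_const).norm).add
        (((hF x).comp continuous_fst).sub continuous_const).norm
    simpa using this.tendsto (a, x)
  rw [ContinuousAt, tendsto_iff_norm_sub_tendsto_zero]
  refine squeeze_zero' (Eventually.of_forall fun _ => norm_nonneg _) ?_ bound_tendsto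
  filter_upwards [continuous_fst.continuousAt.eventually haK] with p hp
  calc ‖F p.1 p.2 - F a x‖ = ‖F p.1 (p.2 - x) + (F p.1 x - F a x)‖ := by
        rw [map_sub]; congr 1; abel
    _ ≤ C * ‖p.2 - x‖ + ‖F p.1 x - F a x‖ :=
        norm_add_le_of_le ((F p.1).le_of_opNorm_le (hC _ hp) _) le_rfl

variable [WeaklyLocallyCompactSpace α]

lemma continuous_apply (hF : StronglyContinuous F) {u : α → X} (hu : Continuous u) :
    Continuous fun a => F a (u a) :=
  hF.continuous_uncurry.comp (continuous_id.prodMk hu)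

lemma comp {G : α → Z →L[ℝ] X} (hF : StronglyContinuous F) (hG : StronglyContinuous G) :
    StronglyContinuous fun a => F a ∘L G a :=
  fun x => hF.continuous_apply (hG x)

lemma aestronglyMeasurable_apply [MeasurableSpace α] [OpensMeasurableSpace α]
    [SecondCountableTopology α] [TopologicalSpace.PseudoMetrizableSpace α]
    (hF : StronglyContinuous F) {μ : Measure α} {u : α → X} (hu : AEStronglyMeasurable u μ) :
    AEStronglyMeasurable (fun a => F a (u a)) μ :=
  hF.continuous_uncurry.comp_aestronglyMeasurable
    (continuous_id.aestronglyMeasurable.prodMk hu)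

end StronglyContinuous

end StrongContinuity

section StrongIntegral

variable {X Y : Type*} [NormedAddCommGroup X] [NormedSpace ℝ X] [CompleteSpace X]
  [NormedAddCommGroup Y] [NormedSpace ℝ Y] {F : ℝ → X →L[ℝ] Y} {a b : ℝ}

lemma StronglyContinuous.exists_integral_clm (hF : StronglyContinuous F) (a b : ℝ) :
    ∃ L : X →L[ℝ] Y, ∀ x, L x = ∫ s in a..b, F s x := by
  obtain ⟨C, -, hC⟩ := hF.exists_norm_le (isCompact_uIcc (a := a) (b := b))
  let L : X →ₗ[ℝ] Y :=
    { toFun := fun x => ∫ s in a..b, F s x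
      map_add' := fun x y => by
        simp only [map_add]
        exact intervalIntegral.integral_add ((hF x).intervalIntegrable _ _)
          ((hF y).intervalIntegrable _ _)
      map_smul' := fun c x => by simp }
  refine ⟨L.mkContinuous (C * |b - a|) fun x => ?_, fun x => rfl⟩
  rw [mul_right_comm]
  exact intervalIntegral.norm_integral_le_of_norm_le_const fun s hs =>
    (F s).le_of_opNorm_le (hC s (uIoc_subset_uIcc hs)) x

open Classical in
/-- The integral of a strongly continuous operator family in the strong operator topology; it is
`0` by convention if no bounded operator represents the pointwise integrals. The norm integral
would not do, since a strongly continuous family need not be measurable in norm. -/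
noncomputable def strongIntegral (F : ℝ → X →L[ℝ] Y) (a b : ℝ) : X →L[ℝ] Y :=
  if h : ∃ L : X →L[ℝ] Y, ∀ x, L x = ∫ s in a..b, F s x then h.choose else 0

lemma strongIntegral_apply (hF : StronglyContinuous F) (x : X) :
    strongIntegral F a b x = ∫ s in a..b, F s x := by
  rw [strongIntegral, dif_pos (hF.exists_integral_clm a b)]
  exact (hF.exists_integral_clm a b).choose_spec x

end StrongIntegral

section Semigroup

variable {H : Type*} [NormedAddCommGroup H] [InnerProductSpace ℝ H] {E : ℝ → H →L[ℝ] H} {M ω : ℝ}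

namespace IsC0Semigroup

lemma apply_add (hE : IsC0Semigroup E) {s t : ℝ} (hs : 0 ≤ s) (ht : 0 ≤ t) (x : H) :
    E (s + t) x = E s (E t x) := by
  rw [hE.add s t hs ht]; rfl

lemma apply_zero (hE : IsC0Semigroup E) (x : H) : E 0 x = x := by
  rw [hE.zero]; rfl

lemma norm_le_pow (hE : IsC0Semigroup E) {δ : ℝ} (hδ : 0 ≤ δ)
    (hb : ∀ t ∈ Icc 0 δ, ‖E t‖ ≤ M) (n : ℕ) :
    ∀ t ∈ Icc 0 δ, ‖E (n * δ + t)‖ ≤ M ^ (n + 1) := by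
  have hM : 0 ≤ M := (norm_nonneg _).trans (hb 0 ⟨le_rfl, hδ⟩)
  induction n with
  | zero => simpa using hb
  | succ n ih =>
    intro t ht
    have split : ((n + 1 : ℕ) : ℝ) * δ + t = δ + (n * δ + t) := by push_cast; ring
    rw [split, hE.add _ _ hδ (by have := ht.1; positivity), pow_succ']
    exact (ContinuousLinearMap.opNorm_comp_le _ _).trans
      (mul_le_mul (hb δ ⟨hδ, le_rfl⟩) (ih t ht) (norm_nonneg _) hM)

lemma norm_apply_sub_apply_le (hE : IsC0Semigroup E) (hω : 0 ≤ ω)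
    (hb : ∀ t, 0 ≤ t → ‖E t‖ ≤ M * Real.exp (ω * t)) {s t : ℝ} (hs : 0 ≤ s) (ht : 0 ≤ t) (x : H) :
    ‖E s x - E t x‖ ≤ M * Real.exp (ω * (s + t)) * ‖E |s - t| x - x‖ := by
  have hM : 0 ≤ M := by simpa using (norm_nonneg _).trans (hb 0 le_rfl)
  wlog hst : t ≤ s generalizing s t
  · rw [norm_sub_rev, abs_sub_comm, add_comm]
    exact this ht hs (le_of_not_ge hst)
  have split : E s x = E t (E (s - t) x) := by
    rw [← hE.apply_add ht (sub_nonneg.2 hst), add_sub_cancel]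
  rw [abs_of_nonneg (sub_nonneg.2 hst), split, ← map_sub]
  refine (E t).le_of_opNorm_le ((hb t ht).trans ?_) _
  gcongr
  linarith

variable [CompleteSpace H]

lemma exists_norm_le_near_zero (hE : IsC0Semigroup E) :
    ∃ δ > 0, ∃ M, 1 ≤ M ∧ ∀ t ∈ Icc 0 δ, ‖E t‖ ≤ M := by
  by_contra hcon
  push Not at hcon
  have blowup : ∀ n : ℕ, ∃ t ∈ Icc (0 : ℝ) (1 / ((n : ℝ) + 1)), (n : ℝ) + 1 < ‖E t‖ := fun n =>
    hcon _ (by positivity) _ (by linarith [(Nat.cast_nonneg n : (0 : ℝ) ≤ n)])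
  choose t ht hbig using blowup
  have t_pos : ∀ n, 0 < t n := fun n => (ht n).1.lt_of_ne fun h => by
    have := hbig n
    rw [← h, hE.zero] at this
    linarith [ContinuousLinearMap.norm_id_le (𝕜 := ℝ) (E := H), (Nat.cast_nonneg n : (0 : ℝ) ≤ n)]
  have t_tendsto : Tendsto t atTop (𝓝[>] 0) :=
    tendsto_nhdsWithin_iff.2 ⟨squeeze_zero (fun n => (t_pos n).le) (fun n => (ht n).2)
      tendsto_one_div_add_atTop_nhds_zero_nat, Eventually.of_forall t_pos⟩
  have pointwise : ∀ x, ∃ C, ∀ n, ‖E (t n) x‖ ≤ C := fun x => by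
    obtain ⟨C, hC⟩ := ((hE.tendsto_zero x).comp t_tendsto).norm.bddAbove_range
    exact ⟨C, fun n => hC ⟨n, rfl⟩⟩
  obtain ⟨C, hC⟩ := banach_steinhaus pointwise
  obtain ⟨n, hn⟩ := exists_nat_gt C
  linarith [hC n, hbig n]

lemma exists_growth_bound (hE : IsC0Semigroup E) :
    ∃ M ω : ℝ, 1 ≤ M ∧ 0 ≤ ω ∧ ∀ t, 0 ≤ t → ‖E t‖ ≤ M * Real.exp (ω * t) := by
  obtain ⟨δ, hδ, M, hM, hb⟩ := hE.exists_norm_le_near_zero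
  have hlog : 0 ≤ Real.log M := Real.log_nonneg hM
  refine ⟨M, Real.log M / δ, hM, by positivity, fun t ht => ?_⟩
  set n := ⌊t / δ⌋₊
  have floor_le : (n : ℝ) ≤ t / δ := Nat.floor_le (by positivity)
  have lower : (n : ℝ) * δ ≤ t := (le_div_iff₀ hδ).1 floor_le
  have upper : t < (n + 1) * δ := (div_lt_iff₀ hδ).1 (Nat.lt_floor_add_one _)
  calc ‖E t‖ ≤ M ^ (n + 1) := by
        simpa using hE.norm_le_pow hδ.le hb n (t - n * δ) ⟨by linarith, by linarith⟩
    _ = M * Real.exp (n * Real.log M) := by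
        rw [Real.exp_nat_mul, Real.exp_log (by linarith), pow_succ']
    _ ≤ M * Real.exp (t / δ * Real.log M) := by gcongr
    _ = M * Real.exp (Real.log M / δ * t) := by ring_nf

lemma continuousOn (hE : IsC0Semigroup E) (x : H) : ContinuousOn (fun t => E t x) (Ici 0) := by
  obtain ⟨M, ω, -, hω, hb⟩ := hE.exists_growth_bound
  have at_zero : Tendsto (fun h => E h x - x) (𝓝[≥] 0) (𝓝 0) := by
    rw [← Ioi_insert, nhdsWithin_insert]
    refine Tendsto.sup ?_ (by simpa using (hE.tendsto_zero x).sub_const x)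
    simpa [hE.apply_zero] using tendsto_pure_nhds (fun h => E h x - x) 0
  intro t ht
  rw [ContinuousWithinAt, tendsto_iff_norm_sub_tendsto_zero]
  have abs_tendsto : Tendsto (fun s : ℝ => |s - t|) (𝓝[Ici 0] t) (𝓝[≥] 0) := by
    refine tendsto_nhdsWithin_iff.2 ⟨?_, Eventually.of_forall fun s => abs_nonneg (s - t)⟩
    have : Continuous fun s : ℝ => |s - t| := by fun_prop
    simpa using (this.tendsto t).mono_left nhdsWithin_le_nhds
  have bound_tendsto : Tendsto (fun s => M * Real.exp (ω * (s + t)) * ‖E |s - t| x - x‖)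
      (𝓝[Ici 0] t) (𝓝 0) := by
    have : Continuous fun s : ℝ => M * Real.exp (ω * (s + t)) := by fun_prop
    simpa using (this.continuousWithinAt (s := Ici 0) (x := t)).tendsto.mul
      (at_zero.comp abs_tendsto).norm
  refine squeeze_zero' (Eventually.of_forall fun _ => norm_nonneg _) ?_ bound_tendsto
  filter_upwards [self_mem_nhdsWithin] with s hs
  exact hE.norm_apply_sub_apply_le hω hb hs ht x

lemma stronglyContinuous_max (hE : IsC0Semigroup E) : StronglyContinuous fun t => E (max t 0) :=
  fun x => (hE.continuousOn x).comp_continuous (by fun_prop) fun t => le_max_right t 0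

end IsC0Semigroup

end Semigroup

section LaplaceTransform

variable {H : Type*} [NormedAddCommGroup H] [InnerProductSpace ℝ H] {E : ℝ → H →L[ℝ] H}
  {M ω l : ℝ} {J : H →L[ℝ] H}

/-- The bounded operator `J` is the Laplace transform `∫₀^∞ e^{-lt} E(t) dt` of the operator family
`E` at `l`, the integral being absolutely convergent in the strong sense. For a `C₀`-semigroup `J`
is the resolvent `(l - A)⁻¹` of the generator. -/
structure IsLaplaceTransform (E : ℝ → H →L[ℝ] H) (l : ℝ) (J : H →L[ℝ] H) : Prop where
  integrableOn : ∀ x, IntegrableOn (fun t => Real.exp (-l * t) • E t x) (Ioi 0)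
  apply_eq : ∀ x, J x = ∫ t in Ioi (0 : ℝ), Real.exp (-l * t) • E t x

lemma norm_exp_smul_le {f : ℝ → H} {c : ℝ} (hf : ∀ t, 0 ≤ t → ‖f t‖ ≤ c * Real.exp (ω * t)) :
    ∀ᵐ t ∂volume.restrict (Ioi 0), ‖Real.exp (-l * t) • f t‖ ≤ c * Real.exp ((ω - l) * t) := by
  filter_upwards [ae_restrict_mem measurableSet_Ioi] with t ht
  rw [norm_smul, Real.norm_of_nonneg (Real.exp_nonneg _)]
  calc _ ≤ Real.exp (-l * t) * (c * Real.exp (ω * t)) := by gcongr; exact hf t (le_of_lt ht)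
    _ = c * Real.exp ((ω - l) * t) := by rw [mul_left_comm, ← Real.exp_add]; ring_nf

lemma integrableOn_const_mul_exp (hl : ω < l) (c : ℝ) :
    IntegrableOn (fun t => c * Real.exp ((ω - l) * t)) (Ioi 0) :=
  (integrableOn_exp_mul_Ioi (by linarith) 0).const_mul c

lemma norm_integral_exp_smul_le (hl : ω < l) {c : ℝ} {f : ℝ → H}
    (hf : ∀ t, 0 ≤ t → ‖f t‖ ≤ c * Real.exp (ω * t)) :
    ‖∫ t in Ioi (0 : ℝ), Real.exp (-l * t) • f t‖ ≤ c / (l - ω) := by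
  have h₁ : l - ω ≠ 0 := by linarith
  have h₂ : ω - l ≠ 0 := by linarith
  refine (norm_integral_le_of_norm_le (integrableOn_const_mul_exp hl c)
    (norm_exp_smul_le hf)).trans_eq ?_
  rw [integral_const_mul, integral_exp_mul_Ioi (by linarith), mul_zero, Real.exp_zero]
  field_simp
  ring

variable [CompleteSpace H]

lemma IsC0Semigroup.exists_isLaplaceTransform (hE : IsC0Semigroup E)
    (hb : ∀ t, 0 ≤ t → ‖E t‖ ≤ M * Real.exp (ω * t)) (hl : ω < l) :
    ∃ J, IsLaplaceTransform E l J := by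
  have hbx : ∀ x : H, ∀ t, 0 ≤ t → ‖E t x‖ ≤ M * ‖x‖ * Real.exp (ω * t) := fun x t ht =>
    ((E t).le_of_opNorm_le (hb t ht) x).trans_eq (by ring)
  have integrable : ∀ x, IntegrableOn (fun t => Real.exp (-l * t) • E t x) (Ioi 0) := fun x => by
    refine (integrableOn_const_mul_exp hl (M * ‖x‖)).mono' ?_ (norm_exp_smul_le (hbx x))
    exact (ContinuousOn.smul (by fun_prop) ((hE.continuousOn x).mono
      Ioi_subset_Ici_self)).aestronglyMeasurable measurableSet_Ioi
  let J : H →ₗ[ℝ] H :=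
    { toFun := fun x => ∫ t in Ioi (0 : ℝ), Real.exp (-l * t) • E t x
      map_add' := fun x y => by
        simp only [map_add, smul_add]
        exact integral_add (integrable x) (integrable y)
      map_smul' := fun c x => by
        simp only [map_smul, RingHom.id_apply, ← integral_smul, smul_comm c] }
  refine ⟨J.mkContinuous (M / (l - ω)) fun x => ?_, integrable, fun x => rfl⟩
  exact (norm_integral_exp_smul_le hl (hbx x)).trans_eq (by ring)

namespace IsLaplaceTransform

lemma semigroup_comm (hJ : IsLaplaceTransform E l J) (hE : IsC0Semigroup E) {t : ℝ} (ht : 0 ≤ t)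
    (x : H) : E t (J x) = J (E t x) := by
  rw [hJ.apply_eq, hJ.apply_eq, ← (E t).integral_comp_comm (hJ.integrableOn x)]
  refine setIntegral_congr_fun measurableSet_Ioi fun s hs => ?_
  simp only [map_smul]
  rw [← hE.apply_add ht (le_of_lt hs), ← hE.apply_add (le_of_lt hs) ht, add_comm]

lemma semigroup_apply (hJ : IsLaplaceTransform E l J) (hE : IsC0Semigroup E) {t : ℝ} (ht : 0 ≤ t)
    (x : H) : E t (J x)
      = Real.exp (l * t) • (J x - ∫ s in (0 : ℝ)..t, Real.exp (-l * s) • E (max s 0) x) := by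
  have tail : J x - ∫ s in (0 : ℝ)..t, Real.exp (-l * s) • E (max s 0) x
      = ∫ s in Ioi t, Real.exp (-l * s) • E s x := by
    rw [sub_eq_iff_eq_add', hJ.apply_eq, ← intervalIntegral.integral_interval_add_Ioi
      (hJ.integrableOn x) ((hJ.integrableOn x).mono_set (Ioi_subset_Ioi ht))]
    congr 1
    refine intervalIntegral.integral_congr fun s hs => ?_
    rw [uIcc_of_le ht] at hs
    simp only [max_eq_left hs.1]
  have translate : ∫ s in Ioi 0, Real.exp (-l * (s + t)) • E (s + t) x
      = ∫ s in Ioi t, Real.exp (-l * s) • E s x := by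
    simpa using (measurePreserving_add_right (volume : Measure ℝ) t).setIntegral_preimage_emb
      (measurableEmbedding_addRight t) (fun s => Real.exp (-l * s) • E s x) (Ioi t)
  rw [tail, ← translate, ← integral_smul, hJ.apply_eq, ← (E t).integral_comp_comm
    (hJ.integrableOn x)]
  refine setIntegral_congr_fun measurableSet_Ioi fun s hs => ?_
  simp only [map_smul, smul_smul]
  rw [← hE.apply_add ht (le_of_lt hs), ← Real.exp_add, add_comm t s]
  ring_nf

lemma hasDerivWithinAt (hJ : IsLaplaceTransform E l J) (hE : IsC0Semigroup E) {t : ℝ} (ht : 0 ≤ t)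
    (x : H) : HasDerivWithinAt (fun s => E s (J x)) (E t (l • J x - x)) (Ici 0) t := by
  have integrand_cont : Continuous fun s => Real.exp (-l * s) • E (max s 0) x :=
    (show Continuous fun s : ℝ => Real.exp (-l * s) by fun_prop).smul (hE.stronglyContinuous_max x)
  have integral_deriv := intervalIntegral.integral_hasDerivAt_right
    (integrand_cont.intervalIntegrable 0 t) (integrand_cont.stronglyMeasurableAtFilter _ _)
    integrand_cont.continuousAt
  have exp_deriv : HasDerivAt (fun s => Real.exp (l * s)) (Real.exp (l * t) * l) t := by
    simpa using ((hasDerivAt_id t).const_mul l).exp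
  refine ((exp_deriv.smul (integral_deriv.const_sub (J x))).hasDerivWithinAt.congr
    (fun s hs => hJ.semigroup_apply hE hs x) (hJ.semigroup_apply hE ht x)).congr_deriv ?_
  have cancel : l * t + -l * t = 0 := by ring
  rw [map_sub, map_smul, hJ.semigroup_apply hE ht x, max_eq_left ht, smul_neg, smul_smul,
    smul_smul, ← Real.exp_add, cancel, Real.exp_zero, one_smul, mul_comm l (Real.exp _)]
  abel

lemma hasDerivWithinAt_zero (hJ : IsLaplaceTransform E l J) (hE : IsC0Semigroup E) (x : H) :
    HasDerivWithinAt (fun s => E s (J x)) (l • J x - x) (Ici 0) 0 := by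
  simpa [hE.apply_zero] using hJ.hasDerivWithinAt hE le_rfl x

lemma apply_of_hasDerivWithinAt (hJ : IsLaplaceTransform E l J) (hE : IsC0Semigroup E) {x y : H}
    (hxy : HasDerivWithinAt (fun s => E s x) y (Ici 0) 0) : J y = l • J x - x := by
  have h : HasDerivWithinAt (fun s => E s (J x)) (J y) (Ici 0) 0 :=
    (J.hasFDerivAt.comp_hasDerivWithinAt 0 hxy).congr
      (fun s hs => hJ.semigroup_comm hE hs x) (hJ.semigroup_comm hE le_rfl x)
  exact (uniqueDiffWithinAt_Ici 0).eq_deriv _ h (hJ.hasDerivWithinAt_zero hE x)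

lemma injective (hJ : IsLaplaceTransform E l J) (hE : IsC0Semigroup E) :
    Function.Injective J := by
  rw [injective_iff_map_eq_zero]
  intro x hx
  have hderiv := hJ.hasDerivWithinAt_zero hE x
  simp only [hx, map_zero, smul_zero, zero_sub] at hderiv
  exact neg_eq_zero.1 ((uniqueDiffWithinAt_Ici 0).eq_deriv _ hderiv (hasDerivWithinAt_const _ _ _))

lemma norm_semigroup_apply_le (hJ : IsLaplaceTransform E l J) (hE : IsC0Semigroup E) (hl : ω < l)
    {c : ℝ} {x : H} (hx : ∀ t, 0 ≤ t → ‖E t x‖ ≤ c * Real.exp (ω * t)) {t : ℝ} (ht : 0 ≤ t) :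
    ‖E t (J x)‖ ≤ c / (l - ω) * Real.exp (ω * t) := by
  rw [hJ.semigroup_comm hE ht, hJ.apply_eq, div_mul_eq_mul_div]
  refine norm_integral_exp_smul_le hl fun s hs => ?_
  rw [← hE.apply_add hs ht]
  refine (hx _ (by positivity)).trans_eq ?_
  rw [mul_assoc, ← Real.exp_add]
  ring_nf

lemma norm_pow_le (hJ : IsLaplaceTransform E l J) (hE : IsC0Semigroup E)
    (hb : ∀ t, 0 ≤ t → ‖E t‖ ≤ M * Real.exp (ω * t)) (hl : ω < l) (k : ℕ) :
    ‖J ^ k‖ ≤ M / (l - ω) ^ k := by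
  have hM : 0 ≤ M := by simpa using (norm_nonneg _).trans (hb 0 le_rfl)
  have : 0 < l - ω := by linarith
  refine ContinuousLinearMap.opNorm_le_bound _ (by positivity) fun x => ?_
  have orbit_bound : ∀ t, 0 ≤ t →
      ‖E t ((J ^ k) x)‖ ≤ M * ‖x‖ / (l - ω) ^ k * Real.exp (ω * t) := by
    induction k with
    | zero => exact fun t ht => ((E t).le_of_opNorm_le (hb t ht) x).trans_eq (by simp; ring)
    | succ k ih =>
      intro t ht
      rw [pow_succ', mul_apply_eq_comp, pow_succ, ← div_div]
      exact hJ.norm_semigroup_apply_le hE hl ih ht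
  have at_zero := orbit_bound 0 le_rfl
  rw [hE.apply_zero, mul_zero, Real.exp_zero, mul_one] at at_zero
  exact at_zero.trans_eq (by ring)

end IsLaplaceTransform

end LaplaceTransform

section Resolvent

variable {H : Type*} [NormedAddCommGroup H] [InnerProductSpace ℝ H] {A : H →ₗ.[ℝ] H}
  {E : ℝ → H →L[ℝ] H} {l : ℝ} {J J' : H →L[ℝ] H}

lemma IsResolvent.unique (h : IsResolvent A l J) (h' : IsResolvent A l J') : J = J' := by
  ext y
  obtain ⟨x, hx, hy⟩ := h'.1 y
  rw [← hx, ← h.2 x, hy]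

lemma IsResolvent.resolventOp_eq (h : IsResolvent A l J) : resolventOp A l = J := by
  have hex : ∃ J : H →L[ℝ] H, IsResolvent A l J := ⟨J, h⟩
  rw [resolventOp, dif_pos hex]
  exact hex.choose_spec.unique h

lemma IsGenerator.mem_graph_iff_hasDerivWithinAt (hA : IsGenerator A E) (hE : IsC0Semigroup E)
    {x y : H} : (x, y) ∈ A.graph ↔ HasDerivWithinAt (fun s => E s x) y (Ici 0) 0 := by
  rw [hA, hasDerivWithinAt_iff_tendsto_slope, Ici_sdiff_left]
  refine tendsto_congr fun s => ?_
  simp [slope_def_module, hE.apply_zero]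

lemma IsLaplaceTransform.isResolvent [CompleteSpace H] (hJ : IsLaplaceTransform E l J)
    (hE : IsC0Semigroup E) (hA : IsGenerator A E) : IsResolvent A l J := by
  refine ⟨fun y => ?_, fun x => ?_⟩
  · obtain ⟨x, hx, hAx⟩ := (LinearPMap.mem_graph_iff A).1
      ((hA.mem_graph_iff_hasDerivWithinAt hE).2 (hJ.hasDerivWithinAt_zero hE y))
    simp only at hx hAx
    exact ⟨x, hx, by rw [hAx, hx]; abel⟩
  · have hx := (hA.mem_graph_iff_hasDerivWithinAt hE).1 (A.mem_graph x)
    rw [map_sub, map_smul, hJ.apply_of_hasDerivWithinAt hE hx]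
    abel

end Resolvent

section DenseRange

lemma tendsto_apply_zero_of_denseRange {ι X Y Z : Type*} [NormedAddCommGroup X] [NormedSpace ℝ X]
    [NormedAddCommGroup Y] [NormedSpace ℝ Y] {f : Filter ι} {L : ι → X →L[ℝ] Y} {C : ℝ}
    (hC : ∀ᶠ i in f, ‖L i‖ ≤ C) {d : Z → X} (hd : DenseRange d)
    (hL : ∀ z, Tendsto (fun i => L i (d z)) f (𝓝 0)) (x : X) :
    Tendsto (fun i => L i x) f (𝓝 0) := by
  rw [Metric.tendsto_nhds]
  intro ε hε
  obtain ⟨z, hz⟩ := hd.exists_dist_lt x (ε := ε / (2 * (|C| + 1))) (by positivity)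
  filter_upwards [hC, Metric.tendsto_nhds.1 (hL z) (ε / 2) (by positivity)] with i hi hi'
  rw [dist_zero_right] at hi' ⊢
  rw [dist_eq_norm] at hz
  calc ‖L i x‖ = ‖L i (x - d z) + L i (d z)‖ := by rw [map_sub, sub_add_cancel]
    _ ≤ (|C| + 1) * ‖x - d z‖ + ‖L i (d z)‖ :=
        norm_add_le_of_le ((L i).le_of_opNorm_le (by linarith [le_abs_self C]) _) le_rfl
    _ < (|C| + 1) * (ε / (2 * (|C| + 1))) + ε / 2 := by gcongr
    _ = ε := by field_simp; ring

lemma denseRange_adjoint_of_injective {X Y : Type*} [NormedAddCommGroup X] [InnerProductSpace ℝ X]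
    [CompleteSpace X] [NormedAddCommGroup Y] [InnerProductSpace ℝ Y] [CompleteSpace Y]
    {L : X →L[ℝ] Y} (hL : Function.Injective L) : DenseRange (L†) := by
  have h := ContinuousLinearMap.orthogonal_range (L†)
  rw [ContinuousLinearMap.adjoint_adjoint,
    show (L : X →ₗ[ℝ] Y).ker = ⊥ from LinearMap.ker_eq_bot.2 hL] at h
  exact (Submodule.dense_iff_topologicalClosure_eq_top).2
    (Submodule.topologicalClosure_eq_top_iff.2 h)

end DenseRange

section AdjointSemigroup

variable {H : Type*} [NormedAddCommGroup H] [InnerProductSpace ℝ H] [CompleteSpace H]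
  {E : ℝ → H →L[ℝ] H} {M ω l : ℝ} {J : H →L[ℝ] H}

lemma IsLaplaceTransform.adjoint (hJ : IsLaplaceTransform E l J)
    (hE' : IsC0Semigroup fun t => (E t)†) (hb : ∀ t, 0 ≤ t → ‖E t‖ ≤ M * Real.exp (ω * t))
    (hl : ω < l) : IsLaplaceTransform (fun t => (E t)†) l (J†) := by
  have hb' : ∀ t, 0 ≤ t → ‖(E t)†‖ ≤ M * Real.exp (ω * t) := by
    simpa only [LinearIsometryEquiv.norm_map] using hb
  obtain ⟨J', hJ'⟩ := hE'.exists_isLaplaceTransform hb' hl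
  suffices J' = J† by rwa [← this]
  refine (ContinuousLinearMap.eq_adjoint_iff _ _).2 fun y x => ?_
  rw [hJ'.apply_eq, hJ.apply_eq, ← integral_inner (hJ.integrableOn x), real_inner_comm,
    ← integral_inner (hJ'.integrableOn y)]
  refine integral_congr_ae (Eventually.of_forall fun t => ?_)
  simp only [real_inner_smul_right, ContinuousLinearMap.adjoint_inner_right, real_inner_comm y]

lemma IsLaplaceTransform.norm_comp_sub_le (hJ : IsLaplaceTransform E l J) (hE : IsC0Semigroup E)
    {C t : ℝ} (ht : 0 ≤ t) (hC : ∀ s ∈ Icc 0 t, ‖E s‖ ≤ C) :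
    ‖E t ∘L J - J‖ ≤ C * ‖l • J - 1‖ * t := by
  have : 0 ≤ C := (norm_nonneg _).trans (hC 0 ⟨le_rfl, ht⟩)
  refine ContinuousLinearMap.opNorm_le_bound _ (by positivity) fun x => ?_
  have increment := norm_image_sub_le_of_norm_deriv_le_segment' (a := 0) (b := t)
    (fun s hs => (hJ.hasDerivWithinAt hE hs.1 x).mono Icc_subset_Ici_self)
    (fun s hs => ContinuousLinearMap.le_of_opNorm_le_of_le _ (hC s ⟨hs.1, hs.2.le⟩)
      ((l • J - 1).le_opNorm x)) t ⟨ht, le_rfl⟩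
  rw [hE.apply_zero] at increment
  exact increment.trans_eq (by ring)

/- Strong continuity at `0` is tested on the range of `J†`, where `J` is a resolvent: there the
convergence is in operator norm, hence survives taking adjoints. -/
lemma IsC0Semigroup.adjoint (hE : IsC0Semigroup E) : IsC0Semigroup fun t => (E t)† where
  zero := by rw [hE.zero, ContinuousLinearMap.adjoint_id]
  add s t hs ht := by rw [add_comm, hE.add t s ht hs, ContinuousLinearMap.adjoint_comp]
  tendsto_zero y := by
    obtain ⟨M, ω, hM, hω, hb⟩ := hE.exists_growth_bound
    obtain ⟨J, hJ⟩ := hE.exists_isLaplaceTransform hb (lt_add_one ω)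
    have near_zero : ∀ᶠ t : ℝ in 𝓝[>] 0, t ∈ Ioo (0 : ℝ) 1 := Ioo_mem_nhdsGT one_pos
    have bound : ∀ t ∈ Icc (0 : ℝ) 1, ‖E t‖ ≤ M * Real.exp ω := fun t ht => by
      refine (hb t ht.1).trans ?_
      gcongr
      exact mul_le_of_le_one_right hω ht.2
    have on_range : ∀ x, Tendsto (fun t => ((E t)† - 1) ((J†) x)) (𝓝[>] 0) (𝓝 0) := fun x => by
      refine squeeze_zero_norm'
        (a := fun t => M * Real.exp ω * ‖(ω + 1) • J - 1‖ * t * ‖x‖) ?_ ?_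
      · filter_upwards [near_zero] with t ht
        have adjoint_eq : ((E t)† - 1) ((J†) x) = ((E t ∘L J - J)†) x := by
          have comm : E t ∘L J = J ∘L E t := by ext; exact hJ.semigroup_comm hE ht.1.le _
          simp [comm, ContinuousLinearMap.adjoint_comp]
        rw [adjoint_eq]
        refine ContinuousLinearMap.le_of_opNorm_le _ ?_ x
        rw [LinearIsometryEquiv.norm_map]
        exact hJ.norm_comp_sub_le hE ht.1.le fun s hs => bound s ⟨hs.1, hs.2.trans ht.2.le⟩
      · have : Continuous fun t : ℝ => M * Real.exp ω * ‖(ω + 1) • J - 1‖ * t * ‖x‖ := by fun_prop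
        simpa using (this.tendsto 0).mono_left nhdsWithin_le_nhds
    have bound' : ∀ᶠ t in 𝓝[>] 0, ‖(E t)† - 1‖ ≤ M * Real.exp ω + 1 := by
      filter_upwards [near_zero] with t ht
      refine norm_sub_le_of_le ?_ ContinuousLinearMap.norm_id_le
      rw [LinearIsometryEquiv.norm_map]
      exact bound t ⟨ht.1.le, ht.2.le⟩
    simpa using (tendsto_apply_zero_of_denseRange bound'
      (denseRange_adjoint_of_injective (hJ.injective hE)) on_range y).add_const y

lemma IsLaplaceTransform.denseRange (hJ : IsLaplaceTransform E l J) (hE : IsC0Semigroup E)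
    (hb : ∀ t, 0 ≤ t → ‖E t‖ ≤ M * Real.exp (ω * t)) (hl : ω < l) : DenseRange J := by
  rw [← ContinuousLinearMap.adjoint_adjoint J]
  exact denseRange_adjoint_of_injective ((hJ.adjoint hE.adjoint hb hl).injective hE.adjoint)

end AdjointSemigroup

section Exponential

variable {H : Type*} [NormedAddCommGroup H] [NormedSpace ℝ H] [CompleteSpace H]

lemma norm_exp_smul_le_of_norm_pow_le {L : H →L[ℝ] H} {M q a : ℝ}
    (hL : ∀ k : ℕ, ‖L ^ k‖ ≤ M * q ^ k) (ha : 0 ≤ a) :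
    ‖NormedSpace.exp (a • L)‖ ≤ M * Real.exp (a * q) := by
  have scalar_series := (NormedSpace.exp_series_hasSum_exp' (𝕂 := ℝ) (a * q)).mul_left M
  rw [← Real.exp_eq_exp_ℝ] at scalar_series
  rw [← (NormedSpace.exp_series_hasSum_exp' (𝕂 := ℝ) (a • L)).tsum_eq]
  refine tsum_of_norm_bounded scalar_series fun k => ?_
  rw [norm_smul, smul_pow, norm_smul, Real.norm_of_nonneg (by positivity),
    Real.norm_of_nonneg (by positivity), smul_eq_mul, mul_pow]
  calc _ ≤ ((k.factorial : ℝ))⁻¹ * (a ^ k * (M * q ^ k)) := by gcongr; exact hL k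
    _ = _ := by ring

lemma exp_smul_sub_smul_one (L : H →L[ℝ] H) (a b t : ℝ) :
    NormedSpace.exp (t • (a • L - b • 1))
      = Real.exp (-(t * b)) • NormedSpace.exp ((t * a) • L) := by
  let _ : NormedAlgebra ℚ (H →L[ℝ] H) := NormedAlgebra.restrictScalars ℚ ℝ _
  have split : t • (a • L - b • 1) = algebraMap ℝ (H →L[ℝ] H) (-(t * b)) + (t * a) • L := by
    rw [Algebra.algebraMap_eq_smul_one]
    module
  rw [split, NormedSpace.exp_add_of_commute (Algebra.commutes _ _),
    ← NormedSpace.algebraMap_exp_comm, ← Real.exp_eq_exp_ℝ, Algebra.algebraMap_eq_smul_one,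
    smul_mul_assoc, one_mul]

end Exponential

section Yosida

variable {H : Type*} [NormedAddCommGroup H] [InnerProductSpace ℝ H] {E : ℝ → H →L[ℝ] H}
  {M ω l n : ℝ} {J Jn : H →L[ℝ] H}

/-- The Yosida approximation `n² J - n` built from the resolvent `J` at `n`. -/
noncomputable def yosidaApprox (n : ℝ) (J : H →L[ℝ] H) : H →L[ℝ] H :=
  n ^ 2 • J - n • 1

variable [CompleteSpace H]

lemma IsLaplaceTransform.norm_exp_yosidaApprox_le (hJ : IsLaplaceTransform E n J)
    (hE : IsC0Semigroup E) (hω : 0 ≤ ω) (hb : ∀ t, 0 ≤ t → ‖E t‖ ≤ M * Real.exp (ω * t))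
    (hn : 0 < n) (hωn : 2 * ω ≤ n) {t : ℝ} (ht : 0 ≤ t) :
    ‖NormedSpace.exp (t • yosidaApprox n J)‖ ≤ M * Real.exp (2 * ω * t) := by
  have hM : 0 ≤ M := by simpa using (norm_nonneg _).trans (hb 0 le_rfl)
  have hnω : 0 < n - ω := by linarith
  have exp_bound : ‖NormedSpace.exp ((t * n ^ 2) • J)‖ ≤ M * Real.exp (t * n ^ 2 * (n - ω)⁻¹) := by
    refine norm_exp_smul_le_of_norm_pow_le (fun k => ?_) (by positivity)
    rw [inv_pow, ← div_eq_mul_inv]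
    exact hJ.norm_pow_le hE hb (sub_pos.1 hnω) k
  have rate : -(t * n) + t * n ^ 2 * (n - ω)⁻¹ ≤ 2 * ω * t := by
    have ratio : n * (n - ω)⁻¹ ≤ 2 := by rw [← div_eq_mul_inv, div_le_iff₀ hnω]; linarith
    calc _ = t * ω * (n * (n - ω)⁻¹) := by field_simp; ring
      _ ≤ t * ω * 2 := by gcongr
      _ = _ := by ring
  rw [yosidaApprox, exp_smul_sub_smul_one, norm_smul, Real.norm_of_nonneg (Real.exp_nonneg _)]
  calc _ ≤ Real.exp (-(t * n)) * (M * Real.exp (t * n ^ 2 * (n - ω)⁻¹)) := by gcongr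
    _ = M * Real.exp (-(t * n) + t * n ^ 2 * (n - ω)⁻¹) := by rw [Real.exp_add]; ring
    _ ≤ M * Real.exp (2 * ω * t) := by gcongr

/- Integrate the derivative `exp((t - s)L) E(s) (y - Lx)` of `s ↦ exp((t - s)L) E(s) x`. -/
lemma IsC0Semigroup.norm_apply_sub_exp_le (hE : IsC0Semigroup E) {L : H →L[ℝ] H}
    (hcomm : ∀ s, 0 ≤ s → ∀ x, L (E s x) = E s (L x)) {x y : H} {t C₁ C₂ : ℝ} (ht : 0 ≤ t)
    (hderiv : ∀ s ∈ Icc 0 t, HasDerivWithinAt (fun s => E s x) (E s y) (Icc 0 t) s)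
    (hC₁ : ∀ s ∈ Icc 0 t, ‖NormedSpace.exp (s • L)‖ ≤ C₁) (hC₂ : ∀ s ∈ Icc 0 t, ‖E s‖ ≤ C₂) :
    ‖E t x - NormedSpace.exp (t • L) x‖ ≤ C₁ * (C₂ * ‖y - L x‖) * t := by
  have path_deriv : ∀ s ∈ Icc 0 t, HasDerivWithinAt
      (fun s => NormedSpace.exp ((t - s) • L) (E s x))
      (NormedSpace.exp ((t - s) • L) (E s (y - L x))) (Icc 0 t) s := fun s hs => by
    have exp_deriv := ((hasDerivAt_exp_smul_const L (t - s)).comp_const_sub t s).hasDerivWithinAt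
      (s := Icc 0 t)
    refine (exp_deriv.clm_apply (hderiv s hs)).congr_deriv ?_
    rw [map_sub, map_sub, ← hcomm s hs.1, _root_.neg_apply, mul_apply_eq_comp, ← sub_eq_neg_add]
  have bound : ∀ s ∈ Ico 0 t,
      ‖NormedSpace.exp ((t - s) • L) (E s (y - L x))‖ ≤ C₁ * (C₂ * ‖y - L x‖) := fun s hs =>
    ContinuousLinearMap.le_of_opNorm_le_of_le _ (hC₁ _ ⟨by linarith [hs.2], by linarith [hs.1]⟩)
      ((E s).le_of_opNorm_le (hC₂ s ⟨hs.1, hs.2.le⟩) _)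
  simpa [hE.apply_zero] using
    norm_image_sub_le_of_norm_deriv_le_segment' path_deriv bound t ⟨ht, le_rfl⟩

lemma IsLaplaceTransform.sub_yosidaApprox_apply (hJ : IsLaplaceTransform E l J)
    (hJn : IsLaplaceTransform E n Jn) (hE : IsC0Semigroup E) (x : H) :
    l • J (J x) - J x - yosidaApprox n Jn (J (J x)) = -Jn ((l • J - 1) ((l • J - 1) x)) := by
  have h₁ := hJn.apply_of_hasDerivWithinAt hE (hJ.hasDerivWithinAt_zero hE (J x))
  have h₂ := hJn.apply_of_hasDerivWithinAt hE (hJ.hasDerivWithinAt_zero hE x)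
  simp only [map_sub, map_smul] at h₁ h₂
  simp only [yosidaApprox, _root_.sub_apply, _root_.smul_apply, one_apply_eq_self, map_sub,
    map_smul]
  linear_combination (norm := module) (n + l) • h₁ - h₂

lemma IsLaplaceTransform.norm_apply_sub_exp_yosidaApprox_le (hJ : IsLaplaceTransform E l J)
    (hJn : IsLaplaceTransform E n Jn) (hE : IsC0Semigroup E) (hω : 0 ≤ ω)
    (hb : ∀ t, 0 ≤ t → ‖E t‖ ≤ M * Real.exp (ω * t)) (hn : 0 < n) (hωn : 2 * ω ≤ n) {t : ℝ}
    (ht : 0 ≤ t) (x : H) :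
    ‖E t (J (J x)) - NormedSpace.exp (t • yosidaApprox n Jn) (J (J x))‖
      ≤ M * Real.exp (2 * ω * t) * (M * Real.exp (ω * t)
        * (M / (n - ω) * ‖(l • J - 1) ((l • J - 1) x)‖)) * t := by
  have hM : 0 ≤ M := by simpa using (norm_nonneg _).trans (hb 0 le_rfl)
  have resolvent_bound : ‖Jn‖ ≤ M / (n - ω) := by
    simpa using hJn.norm_pow_le hE hb (by linarith) 1
  have hcomm : ∀ s, 0 ≤ s → ∀ x, yosidaApprox n Jn (E s x) = E s (yosidaApprox n Jn x) :=
    fun s hs x => by simp [yosidaApprox, hJn.semigroup_comm hE hs]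
  refine (hE.norm_apply_sub_exp_le hcomm ht (y := l • J (J x) - J x)
    (C₁ := M * Real.exp (2 * ω * t)) (C₂ := M * Real.exp (ω * t))
    (fun s hs => (hJ.hasDerivWithinAt hE hs.1 (J x)).mono Icc_subset_Ici_self)
    (fun s hs => ?_) fun s hs => ?_).trans ?_
  · refine (hJn.norm_exp_yosidaApprox_le hE hω hb hn hωn hs.1).trans ?_
    gcongr
    exact hs.2
  · refine (hb s hs.1).trans ?_
    gcongr
    exact hs.2
  · rw [hJ.sub_yosidaApprox_apply hJn hE, norm_neg]
    gcongr
    exact Jn.le_of_opNorm_le resolvent_bound _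

lemma IsC0Semigroup.tendsto_exp_yosidaApprox (hE : IsC0Semigroup E) {J : ℕ → H →L[ℝ] H}
    (hJ : ∀ᶠ n : ℕ in atTop, IsLaplaceTransform E n (J n)) {t : ℝ} (ht : 0 ≤ t) (x : H) :
    Tendsto (fun n : ℕ => NormedSpace.exp (t • yosidaApprox n (J n)) x) atTop (𝓝 (E t x)) := by
  obtain ⟨M, ω, -, hω, hb⟩ := hE.exists_growth_bound
  obtain ⟨J₀, hJ₀⟩ := hE.exists_isLaplaceTransform hb (lt_add_one ω)
  have large : ∀ᶠ n : ℕ in atTop, 0 < (n : ℝ) ∧ 2 * ω ≤ n :=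
    tendsto_natCast_atTop_atTop.eventually ((eventually_gt_atTop 0).and (eventually_ge_atTop _))
  have bound : ∀ᶠ n : ℕ in atTop, ‖E t - NormedSpace.exp (t • yosidaApprox n (J n))‖
      ≤ M * Real.exp (ω * t) + M * Real.exp (2 * ω * t) := by
    filter_upwards [hJ, large] with n hJn hn
    exact norm_sub_le_of_le (hb t ht) (hJn.norm_exp_yosidaApprox_le hE hω hb hn.1 hn.2 ht)
  have on_range : ∀ y, Tendsto (fun n : ℕ => (E t - NormedSpace.exp (t • yosidaApprox n (J n)))
      (J₀ (J₀ y))) atTop (𝓝 0) := fun y => by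
    refine squeeze_zero_norm' (a := fun n : ℕ => M * Real.exp (2 * ω * t) * (M * Real.exp (ω * t)
      * (M / (n - ω) * ‖((ω + 1) • J₀ - 1) (((ω + 1) • J₀ - 1) y)‖)) * t) ?_ ?_
    · filter_upwards [hJ, large] with n hJn hn
      exact hJ₀.norm_apply_sub_exp_yosidaApprox_le hJn hE hω hb hn.1 hn.2 ht y
    · have resolvent_tendsto : Tendsto (fun n : ℕ => M / ((n : ℝ) - ω)) atTop (𝓝 0) :=
        (tendsto_atTop_add_const_right _ (-ω) tendsto_natCast_atTop_atTop).const_div_atTop M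
      simpa using (((resolvent_tendsto.mul_const _).const_mul _).const_mul _).mul_const t
  have dense := hJ₀.denseRange hE hb (lt_add_one ω)
  simpa using (tendsto_apply_zero_of_denseRange bound (dense.comp dense J₀.continuous) on_range
    x).const_sub (E t x)

end Yosida

section YosidaGenerator

variable {H : Type*} [NormedAddCommGroup H] [InnerProductSpace ℝ H] [CompleteSpace H]
  {E : ℝ → H →L[ℝ] H} {A : H →ₗ.[ℝ] H} {M ω : ℝ}

lemma IsGenerator.eventually_isLaplaceTransform_resolventOp (hA : IsGenerator A E)
    (hE : IsC0Semigroup E) (hb : ∀ t, 0 ≤ t → ‖E t‖ ≤ M * Real.exp (ω * t)) :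
    ∀ᶠ n : ℕ in atTop, IsLaplaceTransform E n (resolventOp A n) := by
  filter_upwards [tendsto_natCast_atTop_atTop.eventually (eventually_gt_atTop ω)] with n hn
  obtain ⟨J, hJ⟩ := hE.exists_isLaplaceTransform hb hn
  rwa [(hJ.isResolvent hE hA).resolventOp_eq]

lemma IsGenerator.exists_eventually_norm_exp_yosida_le (hA : IsGenerator A E)
    (hE : IsC0Semigroup E) (T : ℝ) : ∃ C : ℝ, ∀ᶠ n : ℕ in atTop, ∀ t ∈ Icc 0 T,
      ‖NormedSpace.exp (t • yosida A n)‖ ≤ C := by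
  obtain ⟨M, ω, hM, hω, hb⟩ := hE.exists_growth_bound
  refine ⟨M * Real.exp (2 * ω * T), ?_⟩
  filter_upwards [hA.eventually_isLaplaceTransform_resolventOp hE hb, tendsto_natCast_atTop_atTop
    |>.eventually ((eventually_gt_atTop 0).and (eventually_ge_atTop (2 * ω)))] with n hJ hn t ht
  refine (hJ.norm_exp_yosidaApprox_le hE hω hb hn.1 hn.2 ht.1).trans ?_
  gcongr
  exact ht.2

lemma IsGenerator.tendsto_exp_yosida (hA : IsGenerator A E) (hE : IsC0Semigroup E) {t : ℝ}
    (ht : 0 ≤ t) (x : H) :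
    Tendsto (fun n : ℕ => NormedSpace.exp (t • yosida A n) x) atTop (𝓝 (E t x)) := by
  obtain ⟨M, ω, -, -, hb⟩ := hE.exists_growth_bound
  exact hE.tendsto_exp_yosidaApprox (hA.eventually_isLaplaceTransform_resolventOp hE hb) ht x

lemma IsGenerator.tendsto_adjoint_exp_yosida (hA : IsGenerator A E) (hE : IsC0Semigroup E) {t : ℝ}
    (ht : 0 ≤ t) (x : H) :
    Tendsto (fun n : ℕ => ((NormedSpace.exp (t • yosida A n))†) x) atTop (𝓝 (((E t)†) x)) := by
  obtain ⟨M, ω, -, -, hb⟩ := hE.exists_growth_bound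
  have hJ : ∀ᶠ n : ℕ in atTop, IsLaplaceTransform (fun t => (E t)†) n ((resolventOp A n)†) := by
    filter_upwards [hA.eventually_isLaplaceTransform_resolventOp hE hb,
      tendsto_natCast_atTop_atTop.eventually (eventually_gt_atTop ω)] with n hJ hn
    exact hJ.adjoint hE.adjoint hb hn
  refine (hE.adjoint.tendsto_exp_yosidaApprox hJ ht x).congr fun n => ?_
  have adjoint_eq : t • yosidaApprox n ((resolventOp A n)†) = star (t • yosida A n) := by
    simp only [yosidaApprox, yosida, star_smul, star_sub, star_trivial, star_one,
      ← ContinuousLinearMap.star_eq_adjoint, ← ContinuousLinearMap.one_def]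
  rw [adjoint_eq, ← NormedSpace.star_exp, ContinuousLinearMap.star_eq_adjoint]

end YosidaGenerator

section WeightedContraction

lemma tendsto_const_div_two_pow (a : ℝ) : Tendsto (fun k : ℕ => a / 2 ^ k) atTop (𝓝 0) :=
  (tendsto_pow_atTop_atTop_of_one_lt one_lt_two).const_div_atTop a

lemma exists_limit_of_weighted_geometric {α Y : Type*} [NormedAddCommGroup Y] [CompleteSpace Y]
    {u : ℕ → α → Y} {w : α → ℝ} {c : ℝ}
    (hu : ∀ k t, ‖u k t - u (k + 1) t‖ ≤ c / 2 ^ k * w t) :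
    ∃ F : α → Y, (∀ t, Tendsto (fun k => u k t) atTop (𝓝 (F t))) ∧
      ∀ k t, ‖u k t - F t‖ ≤ 2 * c / 2 ^ k * w t := by
  have step_dist : ∀ t k, dist (u k t) (u (k + 1) t) ≤ 2 * c * w t / 2 / 2 ^ k := fun t k => by
    rw [dist_eq_norm]
    exact (hu k t).trans_eq (by ring)
  choose F hF using fun t =>
    cauchySeq_tendsto_of_complete (cauchySeq_of_le_geometric_two (step_dist t))
  refine ⟨F, hF, fun k t => ?_⟩
  rw [← dist_eq_norm]
  exact (dist_le_of_le_geometric_two_of_tendsto (step_dist t) (hF t) k).trans_eq (by ring)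

theorem exists_fixedPoint_of_weighted_contraction {α Y : Type*} [NormedAddCommGroup Y]
    [CompleteSpace Y] {S : Set (α → Y)} {Ψ : (α → Y) → α → Y} {w : α → ℝ} {W : ℝ}
    (hw : ∀ t, w t ≤ W) (hΨ : MapsTo Ψ S S)
    (hcontr : ∀ F ∈ S, ∀ G ∈ S, ∀ c, 0 ≤ c → (∀ t, ‖F t - G t‖ ≤ c * w t) →
      ∀ t, ‖Ψ F t - Ψ G t‖ ≤ c / 2 * w t)
    {F₀ : α → Y} (h₀ : F₀ ∈ S) {c₀ : ℝ} (hc₀ : 0 ≤ c₀) (h₁ : ∀ t, ‖F₀ t - Ψ F₀ t‖ ≤ c₀ * w t)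
    (hclosed : ∀ u : ℕ → α → Y, (∀ k, u k ∈ S) → ∀ F, TendstoUniformly u F atTop → F ∈ S) :
    ∃ F ∈ S, Ψ F = F := by
  let u : ℕ → α → Y := fun k => Ψ^[k] F₀
  have u_succ : ∀ k, u (k + 1) = Ψ (u k) := fun k => Function.iterate_succ_apply' Ψ k F₀
  have u_mem : ∀ k, u k ∈ S := fun k => hΨ.iterate k h₀
  have step : ∀ k t, ‖u k t - u (k + 1) t‖ ≤ c₀ / 2 ^ k * w t := by
    intro k
    induction k with
    | zero => simpa [u] using h₁
    | succ k ih =>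
      intro t
      rw [u_succ, u_succ (k + 1), pow_succ, ← div_div]
      exact hcontr _ (u_mem k) _ (u_mem (k + 1)) _ (by positivity) ih t
  obtain ⟨F, u_tendsto, u_sub_le⟩ := exists_limit_of_weighted_geometric step
  have F_mem : F ∈ S := by
    refine hclosed u u_mem F (Metric.tendstoUniformly_iff.2 fun ε hε => ?_)
    filter_upwards [(tendsto_const_div_two_pow (2 * c₀ * W)).eventually (gt_mem_nhds hε)]
      with k hk t
    rw [dist_comm, dist_eq_norm]
    calc ‖u k t - F t‖ ≤ 2 * c₀ / 2 ^ k * w t := u_sub_le k t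
      _ ≤ 2 * c₀ / 2 ^ k * W := by gcongr; exact hw t
      _ = 2 * c₀ * W / 2 ^ k := by ring
      _ < ε := hk
  refine ⟨F, F_mem, funext fun t => ?_⟩
  have Ψu_tendsto : Tendsto (fun k => u (k + 1) t) atTop (𝓝 (Ψ F t)) := by
    rw [tendsto_iff_norm_sub_tendsto_zero]
    refine squeeze_zero (fun k => norm_nonneg _) (fun k => ?_)
      (tendsto_const_div_two_pow (c₀ * w t))
    rw [u_succ]
    exact (hcontr _ (u_mem k) _ F_mem _ (by positivity) (u_sub_le k) t).trans_eq (by ring)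
  exact tendsto_nhds_unique Ψu_tendsto ((tendsto_add_atTop_iff_nat 1).2 (u_tendsto t))

variable {Y : Type*} [NormedAddCommGroup Y] [NormedSpace ℝ Y]

lemma norm_integral_le_exp_backward {f : ℝ → Y} {t T c μ : ℝ} (ht : t ≤ T) (hμ : 0 < μ)
    (hc : 0 ≤ c) (hf : ∀ s ∈ Icc t T, ‖f s‖ ≤ c * Real.exp (μ * (T - s))) :
    ‖∫ s in t..T, f s‖ ≤ c / μ * Real.exp (μ * (T - t)) := by
  have majorant_integrable : IntervalIntegrable (fun s => c * Real.exp (μ * (T - s))) volume t T :=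
    Continuous.intervalIntegrable (by fun_prop) _ _
  have antideriv : ∀ s ∈ uIcc t T, HasDerivAt (fun s => -(c / μ) * Real.exp (μ * (T - s)))
      (c * Real.exp (μ * (T - s))) s := fun s _ =>
    ((((hasDerivAt_id s).const_sub T).const_mul μ).exp.const_mul (-(c / μ))).congr_deriv
      (by field_simp; simp)
  calc ‖∫ s in t..T, f s‖ ≤ ∫ s in t..T, c * Real.exp (μ * (T - s)) :=
        intervalIntegral.norm_integral_le_of_norm_le ht
          (Eventually.of_forall fun s hs => hf s ⟨hs.1.le, hs.2⟩) majorant_integrable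
    _ = -(c / μ) + c / μ * Real.exp (μ * (T - t)) := by
        rw [intervalIntegral.integral_eq_sub_of_hasDerivAt antideriv majorant_integrable]
        simp
    _ ≤ c / μ * Real.exp (μ * (T - t)) := by
        have : 0 ≤ c / μ := by positivity
        linarith

lemma norm_integral_le_exp_forward {f : ℝ → Y} {t c μ : ℝ} (ht : 0 ≤ t) (hμ : 0 < μ)
    (hc : 0 ≤ c) (hf : ∀ s ∈ Icc 0 t, ‖f s‖ ≤ c * Real.exp (μ * s)) :
    ‖∫ s in (0 : ℝ)..t, f s‖ ≤ c / μ * Real.exp (μ * t) := by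
  have reversed := norm_integral_le_exp_backward (f := fun s => f (t - s)) (c := c) ht hμ hc
    fun s hs => hf (t - s) ⟨by linarith [hs.2], by linarith [hs.1]⟩
  simpa [intervalIntegral.integral_comp_sub_left (fun s => f s) t] using reversed

end WeightedContraction

section Loewner

variable {H : Type*} [NormedAddCommGroup H] [InnerProductSpace ℝ H]

lemma inner_apply_self_le {F : H →L[ℝ] H} {v : ℝ} (hF : ‖F‖ ≤ v) (x : H) :
    inner ℝ (F x) x ≤ v * ‖x‖ ^ 2 :=
  calc inner ℝ (F x) x ≤ ‖F x‖ * ‖x‖ := real_inner_le_norm _ _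
    _ ≤ v * ‖x‖ * ‖x‖ := by gcongr; exact F.le_of_opNorm_le hF x
    _ = v * ‖x‖ ^ 2 := by ring

lemma inner_apply_self_le_of_le {F V : H →L[ℝ] H} {v : ℝ} (hFV : F ≤ V) (hV : ‖V‖ ≤ v) (x : H) :
    inner ℝ (F x) x ≤ v * ‖x‖ ^ 2 := by
  have diff_nonneg : 0 ≤ inner ℝ ((V - F) x) x :=
    ((ContinuousLinearMap.le_def _ _).1 hFV).inner_nonneg_left x
  rw [_root_.sub_apply, inner_sub_left] at diff_nonneg
  linarith [inner_apply_self_le hV x]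

variable {F V : H →L[ℝ] H} {v : ℝ}

/- Positivity of `F` at `v x - F x` gives `v ‖F x‖² ≤ v² ⟨F x, x⟩` after `⟨F (F x), F x⟩` is
bounded by `v ‖F x‖²`. -/
lemma norm_apply_sq_le_of_le (hv : 0 < v) (hF : F.IsPositive) (hFV : F ≤ V) (hV : ‖V‖ ≤ v)
    (x : H) : ‖F x‖ ^ 2 ≤ v * inner ℝ (F x) x := by
  have expand : inner ℝ (F (v • x - F x)) (v • x - F x)
      = v ^ 2 * inner ℝ (F x) x - 2 * v * ‖F x‖ ^ 2 + inner ℝ (F (F x)) (F x) := by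
    have cross : inner ℝ (F (F x)) x = ‖F x‖ ^ 2 := by
      rw [hF.inner_left_eq_inner_right, real_inner_self_eq_norm_sq]
    simp only [map_sub, map_smul, inner_sub_left, inner_sub_right, real_inner_smul_left,
      real_inner_smul_right, real_inner_self_eq_norm_sq, cross]
    ring
  have nonneg := hF.inner_nonneg_left (v • x - F x)
  have le := inner_apply_self_le_of_le hFV hV (F x)
  exact le_of_mul_le_mul_left (by nlinarith) hv

lemma norm_le_of_isPositive_of_le (hv : 0 < v) (hF : F.IsPositive) (hFV : F ≤ V) (hV : ‖V‖ ≤ v) :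
    ‖F‖ ≤ v := by
  refine F.opNorm_le_bound hv.le fun x => le_of_sq_le_sq ?_ (by positivity)
  nlinarith [norm_apply_sq_le_of_le hv hF hFV hV x, inner_apply_self_le_of_le hFV hV x]

lemma isPositive_of_tendsto {ι : Type*} {l : Filter ι} [l.NeBot] {u : ι → H →L[ℝ] H}
    (hu : ∀ i, (u i).IsPositive) (hF : Tendsto u l (𝓝 F)) : F.IsPositive := by
  have pointwise : ∀ x, Tendsto (fun i => u i x) l (𝓝 (F x)) := fun x =>
    ((ContinuousLinearMap.apply ℝ H x).continuous.tendsto F).comp hF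
  rw [ContinuousLinearMap.isPositive_iff]
  refine ⟨fun x y => ?_, fun x =>
    ge_of_tendsto' ((pointwise x).inner tendsto_const_nhds) fun i => (hu i).inner_nonneg_left x⟩
  refine tendsto_nhds_unique ((pointwise x).inner (tendsto_const_nhds (x := y))) ?_
  exact ((tendsto_const_nhds (x := x)).inner (pointwise y)).congr fun i =>
    ((hu i).inner_left_eq_inner_right x y).symm

end Loewner

section StrongIntegralOrder

variable {H : Type*} [NormedAddCommGroup H] [InnerProductSpace ℝ H] [CompleteSpace H]
  {F F' : ℝ → H →L[ℝ] H} {a b : ℝ}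

lemma strongIntegral_sub (hF : StronglyContinuous F) (hF' : StronglyContinuous F') :
    strongIntegral (fun s => F s - F' s) a b = strongIntegral F a b - strongIntegral F' a b := by
  ext x
  rw [_root_.sub_apply, strongIntegral_apply (hF.sub hF'), strongIntegral_apply hF,
    strongIntegral_apply hF', ← intervalIntegral.integral_sub ((hF x).intervalIntegrable _ _)
      ((hF' x).intervalIntegrable _ _)]
  rfl

lemma inner_strongIntegral (hF : StronglyContinuous F) (x y : H) :
    inner ℝ (strongIntegral F a b x) y = ∫ s in a..b, inner ℝ (F s x) y := by
  rw [strongIntegral_apply hF, real_inner_comm]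
  simp_rw [real_inner_comm y]
  exact ((innerSL ℝ y).intervalIntegral_comp_comm
    ((hF x).intervalIntegrable (μ := volume) a b)).symm

lemma isPositive_strongIntegral (hF : StronglyContinuous F) (hab : a ≤ b)
    (hpos : ∀ s ∈ Icc a b, (F s).IsPositive) : (strongIntegral F a b).IsPositive := by
  rw [ContinuousLinearMap.isPositive_iff]
  refine ⟨fun x y => ?_, fun x => ?_⟩
  · change inner ℝ (strongIntegral F a b x) y = inner ℝ x (strongIntegral F a b y)
    rw [← real_inner_comm x, inner_strongIntegral hF, inner_strongIntegral hF]
    refine intervalIntegral.integral_congr fun s hs => ?_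
    rw [uIcc_of_le hab] at hs
    exact ((hpos s hs).inner_left_eq_inner_right x y).trans (real_inner_comm _ _)
  · rw [inner_strongIntegral hF]
    exact intervalIntegral.integral_nonneg hab fun s hs => (hpos s hs).inner_nonneg_left x

lemma norm_strongIntegral_le_exp (hF : StronglyContinuous F) {c μ : ℝ} (hab : a ≤ b) (hμ : 0 < μ)
    (hc : 0 ≤ c) (hle : ∀ s ∈ Icc a b, ‖F s‖ ≤ c * Real.exp (μ * (b - s))) :
    ‖strongIntegral F a b‖ ≤ c / μ * Real.exp (μ * (b - a)) := by
  refine ContinuousLinearMap.opNorm_le_bound _ (by positivity) fun x => ?_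
  rw [strongIntegral_apply hF]
  calc ‖∫ s in a..b, F s x‖ ≤ c * ‖x‖ / μ * Real.exp (μ * (b - a)) :=
        norm_integral_le_exp_backward hab hμ (by positivity) fun s hs =>
          ((F s).le_of_opNorm_le (hle s hs) x).trans_eq (by ring)
    _ = c / μ * Real.exp (μ * (b - a)) * ‖x‖ := by ring

end StrongIntegralOrder

section Lyapunov

variable {H : Type*} [NormedAddCommGroup H] [InnerProductSpace ℝ H] [CompleteSpace H]

/-- A family of bounded operators that is, together with its adjoints, continuous in the strong
operator topology. -/
structure StarStronglyContinuous (F : ℝ → H →L[ℝ] H) : Prop where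
  apply : StronglyContinuous F
  adjoint_apply : StronglyContinuous fun t => (F t)†

lemma StarStronglyContinuous.smul {F : ℝ → H →L[ℝ] H} (hF : StarStronglyContinuous F) {c : ℝ → ℝ}
    (hc : Continuous c) : StarStronglyContinuous fun t => c t • F t where
  apply := hF.apply.smul hc
  adjoint_apply := by simpa using hF.adjoint_apply.smul hc

lemma StarStronglyContinuous.comp_continuous {F : ℝ → H →L[ℝ] H} (hF : StarStronglyContinuous F)
    {τ : ℝ → ℝ} (hτ : Continuous τ) : StarStronglyContinuous fun t => F (τ t) where
  apply := hF.apply.comp_continuous hτ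
  adjoint_apply := hF.adjoint_apply.comp_continuous hτ

lemma StarStronglyContinuous.adjoint {F : ℝ → H →L[ℝ] H} (hF : StarStronglyContinuous F) :
    StarStronglyContinuous fun t => (F t)† where
  apply := hF.adjoint_apply
  adjoint_apply := by simpa only [ContinuousLinearMap.adjoint_adjoint] using hF.apply

lemma StarStronglyContinuous.const (L : H →L[ℝ] H) : StarStronglyContinuous fun _ => L where
  apply := .const L
  adjoint_apply := .const (L†)

lemma StarStronglyContinuous.comp {F G : ℝ → H →L[ℝ] H} (hF : StarStronglyContinuous F)
    (hG : StarStronglyContinuous G) : StarStronglyContinuous fun t => F t ∘L G t where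
  apply := hF.apply.comp hG.apply
  adjoint_apply := by
    simpa only [ContinuousLinearMap.adjoint_comp] using hG.adjoint_apply.comp hF.adjoint_apply

/-- A `C₀`-semigroup extended to a star-strongly continuous family on the whole line; the values at
negative times are arbitrary. -/
structure IsSemigroupFamily (e : ℝ → H →L[ℝ] H) : Prop extends StarStronglyContinuous e where
  zero : e 0 = .id ℝ H
  add : ∀ s t, 0 ≤ s → 0 ≤ t → e (s + t) = e s ∘L e t

lemma IsSemigroupFamily.exp_smul {e : ℝ → H →L[ℝ] H} (he : IsSemigroupFamily e) (ν : ℝ) :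
    IsSemigroupFamily fun t => Real.exp (ν * t) • e t where
  toStarStronglyContinuous := he.toStarStronglyContinuous.smul (by fun_prop)
  zero := by simp [he.zero]
  add s t hs ht := by
    ext x
    simp [he.add s t hs ht, mul_add, Real.exp_add, smul_smul, mul_comm]

/-- The mild solution operator of the backward Lyapunov equation `P' + A* P + P A + h = 0`,
`P(T) = G`, where `e t` stands for `e^{tA}`. -/
noncomputable def lyapunovMap (e : ℝ → H →L[ℝ] H) (T : ℝ) (G : H →L[ℝ] H) (h : ℝ → H →L[ℝ] H)
    (t : ℝ) : H →L[ℝ] H :=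
  (e (T - t))† ∘L G ∘L e (T - t) + strongIntegral (fun s => (e (s - t))† ∘L h s ∘L e (s - t)) t T

variable {e : ℝ → H →L[ℝ] H} {T : ℝ} {G : H →L[ℝ] H} {h h' : ℝ → H →L[ℝ] H}

lemma StarStronglyContinuous.conj {α : Type*} [TopologicalSpace α] [WeaklyLocallyCompactSpace α]
    (he : StarStronglyContinuous e) {g : α → H →L[ℝ] H} (hg : StronglyContinuous g) {τ : α → ℝ}
    (hτ : Continuous τ) : StronglyContinuous fun a => (e (τ a))† ∘L g a ∘L e (τ a) :=
  (he.adjoint_apply.comp_continuous hτ).comp (hg.comp (he.apply.comp_continuous hτ))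

lemma StarStronglyContinuous.conj_sub (he : StarStronglyContinuous e) (hh : StronglyContinuous h)
    (t : ℝ) : StronglyContinuous fun s => (e (s - t))† ∘L h s ∘L e (s - t) :=
  he.conj hh (continuous_sub_right t)

lemma lyapunovMap_apply (he : StarStronglyContinuous e) (hh : StronglyContinuous h) (t : ℝ)
    (x : H) : lyapunovMap e T G h t x
      = ((e (T - t))†) (G (e (T - t) x)) + ∫ s in t..T, ((e (s - t))†) (h s (e (s - t) x)) := by
  rw [lyapunovMap, _root_.add_apply, strongIntegral_apply (he.conj_sub hh t)]
  rfl

lemma lyapunovMap_congr (he : StarStronglyContinuous e) (hh : StronglyContinuous h)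
    (hh' : StronglyContinuous h') {t : ℝ} (ht : t ≤ T) (hs : ∀ s ∈ Icc t T, h s = h' s) :
    lyapunovMap e T G h t = lyapunovMap e T G h' t := by
  ext x
  rw [lyapunovMap_apply he hh, lyapunovMap_apply he hh']
  congr 1
  refine intervalIntegral.integral_congr fun s hs' => ?_
  rw [uIcc_of_le ht] at hs'
  simp only [hs s hs']

lemma stronglyContinuous_lyapunovMap (he : StarStronglyContinuous e) (hh : StronglyContinuous h) :
    StronglyContinuous (lyapunovMap e T G h) := by
  intro x
  simp only [lyapunovMap_apply he hh, intervalIntegral.integral_symm T]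
  refine Continuous.add (he.conj (.const G) (continuous_sub_left T) x) (Continuous.neg ?_)
  have integrand : Continuous fun p : ℝ × ℝ => ((e (p.2 - p.1))†) (h p.2 (e (p.2 - p.1) x)) :=
    he.conj (hh.comp_continuous continuous_snd) (continuous_snd.sub continuous_fst) x
  exact intervalIntegral.continuous_parametric_intervalIntegral_of_continuous integrand
    continuous_id

lemma isPositive_lyapunovMap (he : StarStronglyContinuous e) (hh : StronglyContinuous h)
    {t : ℝ} (ht : t ≤ T) (hG : G.IsPositive) (hpos : ∀ s ∈ Icc t T, (h s).IsPositive) :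
    (lyapunovMap e T G h t).IsPositive :=
  (hG.adjoint_conj _).add (isPositive_strongIntegral (he.conj_sub hh t) ht fun s hs =>
    (hpos s hs).adjoint_conj _)

lemma lyapunovMap_sub (he : StarStronglyContinuous e) (hh : StronglyContinuous h)
    (hh' : StronglyContinuous h') (t : ℝ) :
    lyapunovMap e T G h t - lyapunovMap e T G h' t
      = strongIntegral (fun s => (e (s - t))† ∘L (h s - h' s) ∘L e (s - t)) t T := by
  rw [lyapunovMap, lyapunovMap, add_sub_add_left_eq_sub,
    ← strongIntegral_sub (he.conj_sub hh t) (he.conj_sub hh' t)]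
  simp only [ContinuousLinearMap.sub_comp, ContinuousLinearMap.comp_sub]

lemma lyapunovMap_mono (he : StarStronglyContinuous e) (hh : StronglyContinuous h)
    (hh' : StronglyContinuous h') {t : ℝ} (ht : t ≤ T) (hle : ∀ s ∈ Icc t T, h s ≤ h' s) :
    lyapunovMap e T G h t ≤ lyapunovMap e T G h' t := by
  rw [ContinuousLinearMap.le_def, lyapunovMap_sub he hh' hh]
  exact isPositive_strongIntegral (he.conj_sub (hh'.sub hh) t) ht fun s hs =>
    ((ContinuousLinearMap.le_def _ _).1 (hle s hs)).adjoint_conj _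

lemma norm_lyapunovMap_sub_le (he : StarStronglyContinuous e) (hh : StronglyContinuous h)
    (hh' : StronglyContinuous h') {t M c μ : ℝ} (ht : t ∈ Icc 0 T) (hM : ∀ s ∈ Icc 0 T, ‖e s‖ ≤ M)
    (hc : 0 ≤ c) (hμ : 0 < μ) (hle : ∀ s ∈ Icc t T, ‖h s - h' s‖ ≤ c * Real.exp (μ * (T - s))) :
    ‖lyapunovMap e T G h t - lyapunovMap e T G h' t‖ ≤ M ^ 2 * c / μ * Real.exp (μ * (T - t)) := by
  have : 0 ≤ M := (norm_nonneg _).trans (hM t ht)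
  rw [lyapunovMap_sub he hh hh']
  refine norm_strongIntegral_le_exp (he.conj_sub (hh.sub hh') t) ht.2 hμ (by positivity)
    fun s hs => ?_
  have e_le : ‖e (s - t)‖ ≤ M := hM _ ⟨by linarith [hs.1], by linarith [hs.2, ht.1]⟩
  calc ‖(e (s - t))† ∘L (h s - h' s) ∘L e (s - t)‖
      ≤ ‖(e (s - t))†‖ * (‖h s - h' s‖ * ‖e (s - t)‖) :=
        (ContinuousLinearMap.opNorm_comp_le _ _).trans
          (mul_le_mul_of_nonneg_left (ContinuousLinearMap.opNorm_comp_le _ _) (norm_nonneg _))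
    _ ≤ M * (c * Real.exp (μ * (T - s)) * M) := by
        rw [LinearIsometryEquiv.norm_map]
        gcongr
        exact hle s hs
    _ = M ^ 2 * c * Real.exp (μ * (T - s)) := by ring

lemma conj_lyapunovMap_apply (he : IsSemigroupFamily e) (hh : StronglyContinuous h) {t s : ℝ}
    (hts : t ≤ s) (hsT : s ≤ T) (x : H) :
    ((e (s - t))†) (lyapunovMap e T G h s (e (s - t) x))
      = ((e (T - t))†) (G (e (T - t) x)) + ∫ u in s..T, ((e (u - t))†) (h u (e (u - t) x)) := by
  have e_eq : ∀ u, s ≤ u → e (u - t) = e (u - s) ∘L e (s - t) := fun u hu => by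
    rw [← he.add _ _ (sub_nonneg.2 hu) (sub_nonneg.2 hts), sub_add_sub_cancel]
  have conj_apply : ∀ u, s ≤ u → ∀ (L : H →L[ℝ] H), ((e (u - t))†) (L (e (u - t) x))
      = ((e (s - t))†) (((e (u - s))†) (L (e (u - s) (e (s - t) x)))) := fun u hu L => by
    rw [e_eq u hu, ContinuousLinearMap.adjoint_comp]
    rfl
  rw [lyapunovMap_apply he.toStarStronglyContinuous hh, map_add, conj_apply T hsT G]
  congr 1
  refine (ContinuousLinearMap.intervalIntegral_comp_comm _
    ((he.toStarStronglyContinuous.conj_sub hh s (e (s - t) x)).intervalIntegrable _ _)).symm.trans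
    ?_
  refine intervalIntegral.integral_congr fun u hu => ?_
  rw [uIcc_of_le hsT] at hu
  exact (conj_apply u hu.1 (h u)).symm

lemma integral_exp_smul_add_primitive {E : Type*} [NormedAddCommGroup E] [NormedSpace ℝ E]
    [CompleteSpace E] {k : ℝ → E} (hk : Continuous k) (g : E) (ν t T : ℝ) :
    ∫ s in t..T, Real.exp (-ν * (s - t)) • (k s + ν • (g + ∫ u in s..T, k u))
      = g + (∫ u in t..T, k u) - Real.exp (-ν * (T - t)) • g := by
  have primitive_deriv : ∀ s, HasDerivAt (fun s => ∫ u in s..T, k u) (-k s) s := fun s =>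
    intervalIntegral.integral_hasDerivAt_left (hk.intervalIntegrable _ _)
      (hk.stronglyMeasurableAtFilter _ _) hk.continuousAt
  have : Continuous fun s => ∫ u in s..T, k u :=
    continuous_iff_continuousAt.2 fun s => (primitive_deriv s).continuousAt
  have deriv : ∀ s ∈ uIcc t T, HasDerivAt
      (fun s => -(Real.exp (-ν * (s - t)) • (g + ∫ u in s..T, k u)))
      (Real.exp (-ν * (s - t)) • (k s + ν • (g + ∫ u in s..T, k u))) s := fun s _ => by
    refine ((((hasDerivAt_id s).sub_const t).const_mul (-ν)).exp.smul
      ((primitive_deriv s).const_add g)).neg.congr_deriv ?_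
    simp only [id]
    module
  rw [intervalIntegral.integral_eq_sub_of_hasDerivAt deriv
    (Continuous.intervalIntegrable (by fun_prop) _ _)]
  simp only [intervalIntegral.integral_same, sub_self, mul_zero, Real.exp_zero]
  module

/- Moving `ν P` from the generator to the source term of the Lyapunov equation does not change its
mild solution. -/
lemma lyapunovMap_exp_smul (he : IsSemigroupFamily e) (hh : StronglyContinuous h) (ν : ℝ) {t : ℝ}
    (ht : t ≤ T) :
    lyapunovMap (fun t => Real.exp (-(ν / 2) * t) • e t) T G
        (fun s => h s + ν • lyapunovMap e T G h s) t
      = lyapunovMap e T G h t := by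
  have hW := stronglyContinuous_lyapunovMap (G := G) (T := T) he.toStarStronglyContinuous hh
  have conj_smul : ∀ (s : ℝ) (L : H →L[ℝ] H) (x : H),
      ((Real.exp (-(ν / 2) * s) • e s)†) (L ((Real.exp (-(ν / 2) * s) • e s) x))
        = Real.exp (-ν * s) • ((e s)†) (L (e s x)) := fun s L x => by
    have exp_eq : Real.exp (-ν * s) = Real.exp (-(ν / 2) * s) * Real.exp (-(ν / 2) * s) := by
      rw [← Real.exp_add]
      ring_nf
    rw [exp_eq]
    simp [smul_smul]
  have integral_eq : ∀ x, ∫ s in t..T, ((Real.exp (-(ν / 2) * (s - t)) • e (s - t))†)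
        ((h s + ν • lyapunovMap e T G h s) ((Real.exp (-(ν / 2) * (s - t)) • e (s - t)) x))
      = ((e (T - t))†) (G (e (T - t) x)) + (∫ s in t..T, ((e (s - t))†) (h s (e (s - t) x)))
        - Real.exp (-ν * (T - t)) • ((e (T - t))†) (G (e (T - t) x)) := fun x => by
    refine Eq.trans (intervalIntegral.integral_congr fun s hs => ?_)
      (integral_exp_smul_add_primitive (he.toStarStronglyContinuous.conj_sub hh t x) _ ν t T)
    rw [uIcc_of_le ht] at hs
    beta_reduce
    rw [conj_smul, _root_.add_apply, _root_.smul_apply, map_add, map_smul,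
      conj_lyapunovMap_apply he hh hs.1 hs.2]
    rfl
  ext x
  rw [lyapunovMap_apply (he.exp_smul _).toStarStronglyContinuous
      (hh.add (hW.smul continuous_const)), lyapunovMap_apply he.toStarStronglyContinuous hh,
    integral_eq, conj_smul]
  abel

end Lyapunov

section RiccatiSource

variable {H : Type*} [NormedAddCommGroup H] [InnerProductSpace ℝ H]

/-- The source term `Q - F K F + λ F` of the Riccati equation after `λ P` has been moved out of the
generator, which for `λ = ‖K‖ v` makes it nonnegative as long as `‖F‖ ≤ v`. -/
def riccatiSource (Q K : H →L[ℝ] H) (lam : ℝ) (F : H →L[ℝ] H) : H →L[ℝ] H :=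
  Q - F ∘L K ∘L F + lam • F

variable {Q K F F' V : H →L[ℝ] H} {v : ℝ}

lemma isPositive_riccatiSource [CompleteSpace H] (hQ : Q.IsPositive) (hK : K.IsPositive)
    (hv : 0 < v) (hF : F.IsPositive) (hFV : F ≤ V) (hV : ‖V‖ ≤ v) :
    (riccatiSource Q K (‖K‖ * v) F).IsPositive := by
  have shift_pos : ((‖K‖ * v) • F - F ∘L K ∘L F).IsPositive := by
    rw [ContinuousLinearMap.isPositive_iff]
    refine ⟨fun x y => ?_, fun x => ?_⟩
    · simp [inner_sub_left, inner_sub_right, real_inner_smul_left, real_inner_smul_right,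
        hF.inner_left_eq_inner_right, hK.inner_left_eq_inner_right]
    · have conj_le : inner ℝ (F (K (F x))) x ≤ ‖K‖ * v * inner ℝ (F x) x := by
        calc inner ℝ (F (K (F x))) x = inner ℝ (K (F x)) (F x) := hF.inner_left_eq_inner_right _ _
          _ ≤ ‖K‖ * ‖F x‖ ^ 2 := inner_apply_self_le le_rfl _
          _ ≤ ‖K‖ * (v * inner ℝ (F x) x) := by
              gcongr
              exact norm_apply_sq_le_of_le hv hF hFV hV x
          _ = ‖K‖ * v * inner ℝ (F x) x := by ring
      simpa [inner_sub_left, real_inner_smul_left] using conj_le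
  rw [riccatiSource, sub_add_eq_add_sub, add_sub_assoc]
  exact hQ.add shift_pos

lemma riccatiSource_le [CompleteSpace H] {lam : ℝ} (hlam : 0 ≤ lam) (hK : K.IsPositive)
    (hF : F.IsPositive) (hFV : F ≤ V) : riccatiSource Q K lam F ≤ Q + lam • V := by
  have split : Q + lam • V - riccatiSource Q K lam F = lam • (V - F) + F† ∘L K ∘L F := by
    rw [riccatiSource, hF.isSelfAdjoint.adjoint_eq]
    module
  rw [ContinuousLinearMap.le_def, split]
  exact (((ContinuousLinearMap.le_def _ _).1 hFV).smul_of_nonneg hlam).add (hK.adjoint_conj F)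

lemma norm_riccatiSource_sub_le {lam : ℝ} (hlam : 0 ≤ lam) (hF : ‖F‖ ≤ v) (hF' : ‖F'‖ ≤ v) :
    ‖riccatiSource Q K lam F - riccatiSource Q K lam F'‖ ≤ (lam + 2 * v * ‖K‖) * ‖F - F'‖ := by
  have split : riccatiSource Q K lam F - riccatiSource Q K lam F' = lam • (F - F')
      - ((F - F') ∘L K ∘L F + F' ∘L K ∘L (F - F')) := by
    simp only [riccatiSource, ContinuousLinearMap.sub_comp, ContinuousLinearMap.comp_sub]
    module
  have : 0 ≤ v := (norm_nonneg _).trans hF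
  have left_le : ‖(F - F') ∘L K ∘L F‖ ≤ ‖F - F'‖ * (‖K‖ * v) :=
    calc ‖(F - F') ∘L K ∘L F‖ ≤ ‖F - F'‖ * ‖K ∘L F‖ := ContinuousLinearMap.opNorm_comp_le _ _
      _ ≤ ‖F - F'‖ * (‖K‖ * ‖F‖) := by
          gcongr
          exact ContinuousLinearMap.opNorm_comp_le _ _
      _ ≤ ‖F - F'‖ * (‖K‖ * v) := by gcongr
  have right_le : ‖F' ∘L K ∘L (F - F')‖ ≤ v * (‖K‖ * ‖F - F'‖) :=
    calc ‖F' ∘L K ∘L (F - F')‖ ≤ ‖F'‖ * ‖K ∘L (F - F')‖ := ContinuousLinearMap.opNorm_comp_le _ _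
      _ ≤ v * (‖K‖ * ‖F - F'‖) := by
          gcongr
          exact ContinuousLinearMap.opNorm_comp_le _ _
  calc ‖riccatiSource Q K lam F - riccatiSource Q K lam F'‖
      ≤ ‖lam • (F - F')‖ + (‖(F - F') ∘L K ∘L F‖ + ‖F' ∘L K ∘L (F - F')‖) := by
        rw [split]
        exact norm_sub_le_of_le le_rfl (norm_add_le _ _)
    _ ≤ lam * ‖F - F'‖ + (‖F - F'‖ * (‖K‖ * v) + v * (‖K‖ * ‖F - F'‖)) := by
        rw [norm_smul, Real.norm_of_nonneg hlam]
        gcongr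
    _ = (lam + 2 * v * ‖K‖) * ‖F - F'‖ := by ring

lemma StronglyContinuous.riccatiSource {α : Type*} [TopologicalSpace α]
    [WeaklyLocallyCompactSpace α] [CompleteSpace H] {P : α → H →L[ℝ] H}
    (hP : StronglyContinuous P) (Q K : H →L[ℝ] H) (lam : ℝ) :
    StronglyContinuous fun t => riccatiSource Q K lam (P t) :=
  ((StronglyContinuous.const Q).sub (hP.comp ((StronglyContinuous.const K).comp hP))).add
    (hP.smul continuous_const)

lemma StronglyContinuous.of_tendstoUniformly {α : Type*} [TopologicalSpace α]
    {u : ℕ → α → H →L[ℝ] H} {P : α → H →L[ℝ] H} (hu : ∀ k, StronglyContinuous (u k))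
    (hP : TendstoUniformly u P atTop) : StronglyContinuous P := fun x =>
  ((ContinuousLinearMap.apply ℝ H x).uniformContinuous.comp_tendstoUniformly hP).continuous
    (Frequently.of_forall fun k => hu k x)

end RiccatiSource

section Riccati

variable {H : Type*} [NormedAddCommGroup H] [InnerProductSpace ℝ H]

/-- The strongly continuous `P : [0,T] → Σ⁺(H)` with `P ≤ V`. -/
def positiveMinorants (T : ℝ) (V : ℝ → H →L[ℝ] H) : Set (Icc 0 T → H →L[ℝ] H) :=
  {P | StronglyContinuous P ∧ ∀ t, (P t).IsPositive ∧ P t ≤ V t}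

variable {T v : ℝ} {V : ℝ → H →L[ℝ] H} {P P' : Icc 0 T → H →L[ℝ] H}

lemma StronglyContinuous.iccExtend (hT : 0 ≤ T) (hP : StronglyContinuous P) :
    StronglyContinuous (IccExtend hT P) :=
  hP.comp_continuous continuous_projIcc

lemma norm_le_of_mem_positiveMinorants (hv : 0 < v) (hV : ∀ t ∈ Icc 0 T, ‖V t‖ ≤ v)
    (hP : P ∈ positiveMinorants T V) (t : Icc 0 T) : ‖P t‖ ≤ v :=
  norm_le_of_isPositive_of_le hv (hP.2 t).1 (hP.2 t).2 (hV t t.2)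

lemma mem_positiveMinorants_of_tendstoUniformly {u : ℕ → Icc 0 T → H →L[ℝ] H}
    (hu : ∀ k, u k ∈ positiveMinorants T V) (hP : TendstoUniformly u P atTop) :
    P ∈ positiveMinorants T V :=
  ⟨.of_tendstoUniformly (fun k => (hu k).1) hP, fun t =>
    ⟨isPositive_of_tendsto (fun k => ((hu k).2 t).1) (hP.tendsto_at t),
      (ContinuousLinearMap.le_def _ _).2 <| isPositive_of_tendsto
        (fun k => (ContinuousLinearMap.le_def _ _).1 ((hu k).2 t).2)
        (tendsto_const_nhds.sub (hP.tendsto_at t))⟩⟩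

variable [CompleteSpace H]

/-- The Picard map `P ↦ Φ(Q - P K P + λ P)` of the Riccati equation, where `Φ` solves the Lyapunov
equation with generator `A - λ/2`. -/
noncomputable def riccatiMap (e : ℝ → H →L[ℝ] H) {T : ℝ} (hT : 0 ≤ T) (G Q K : H →L[ℝ] H)
    (lam : ℝ) (P : Icc 0 T → H →L[ℝ] H) (t : Icc 0 T) : H →L[ℝ] H :=
  lyapunovMap (fun t => Real.exp (-(lam / 2) * t) • e t) T G
    (fun s => riccatiSource Q K lam (IccExtend hT P s)) t

variable {e : ℝ → H →L[ℝ] H} {M μ : ℝ} {hT : 0 ≤ T} {G Q K : H →L[ℝ] H}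

lemma mapsTo_riccatiMap (he : IsSemigroupFamily e) (hG : G.IsPositive) (hQ : Q.IsPositive)
    (hK : K.IsPositive) (hv : 0 < v)
    (hV : ∀ t ∈ Icc 0 T, ‖lyapunovMap e T G (fun _ => Q) t‖ ≤ v) :
    MapsTo (riccatiMap e hT G Q K (‖K‖ * v)) (positiveMinorants T (lyapunovMap e T G fun _ => Q))
      (positiveMinorants T (lyapunovMap e T G fun _ => Q)) := by
  intro P hP
  have he' := (he.exp_smul (-(‖K‖ * v / 2))).toStarStronglyContinuous
  have source_cont := (hP.1.iccExtend hT).riccatiSource Q K (‖K‖ * v)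
  have V_cont : StronglyContinuous (lyapunovMap e T G fun _ => Q) :=
    stronglyContinuous_lyapunovMap he.toStarStronglyContinuous (.const Q)
  have mem_Icc : ∀ t : Icc 0 T, ∀ s ∈ Icc (t : ℝ) T, s ∈ Icc 0 T := fun t s hs =>
    ⟨t.2.1.trans hs.1, hs.2⟩
  have bounds : ∀ s ∈ Icc 0 T, (IccExtend hT P s).IsPositive ∧
      IccExtend hT P s ≤ lyapunovMap e T G (fun _ => Q) s := fun s hs => by
    rw [IccExtend_of_mem hT P hs]
    exact hP.2 ⟨s, hs⟩
  refine ⟨(stronglyContinuous_lyapunovMap he' source_cont).comp_continuous continuous_subtype_val,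
    fun t => ⟨isPositive_lyapunovMap he' source_cont t.2.2 hG fun s hs => ?_, ?_⟩⟩
  · obtain ⟨hpos, hle⟩ := bounds s (mem_Icc t s hs)
    exact isPositive_riccatiSource hQ hK hv hpos hle (hV s (mem_Icc t s hs))
  · rw [← lyapunovMap_exp_smul he (.const Q) (‖K‖ * v) t.2.2]
    refine lyapunovMap_mono he' source_cont
      ((StronglyContinuous.const Q).add (V_cont.smul continuous_const)) t.2.2 fun s hs => ?_
    obtain ⟨hpos, hle⟩ := bounds s (mem_Icc t s hs)
    exact riccatiSource_le (by positivity) hK hpos hle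

lemma norm_riccatiMap_sub_le (he : IsSemigroupFamily e) (hv : 0 < v)
    (hV : ∀ t ∈ Icc 0 T, ‖V t‖ ≤ v)
    (hM : ∀ t ∈ Icc 0 T, ‖Real.exp (-(‖K‖ * v / 2) * t) • e t‖ ≤ M)
    (hμ : 6 * M ^ 2 * ‖K‖ * v < μ) (hP : P ∈ positiveMinorants T V)
    (hP' : P' ∈ positiveMinorants T V) {c : ℝ} (hc : 0 ≤ c)
    (hle : ∀ t : Icc 0 T, ‖P t - P' t‖ ≤ c * Real.exp (μ * (T - t))) (t : Icc 0 T) :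
    ‖riccatiMap e hT G Q K (‖K‖ * v) P t - riccatiMap e hT G Q K (‖K‖ * v) P' t‖
      ≤ c / 2 * Real.exp (μ * (T - t)) := by
  have : 0 < μ := lt_of_le_of_lt (by positivity) hμ
  have source_le : ∀ s ∈ Icc (t : ℝ) T, ‖riccatiSource Q K (‖K‖ * v) (IccExtend hT P s)
      - riccatiSource Q K (‖K‖ * v) (IccExtend hT P' s)‖
        ≤ 3 * ‖K‖ * v * c * Real.exp (μ * (T - s)) := fun s hs => by
    have hs' : s ∈ Icc 0 T := ⟨t.2.1.trans hs.1, hs.2⟩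
    rw [IccExtend_of_mem hT P hs', IccExtend_of_mem hT P' hs']
    calc _ ≤ (‖K‖ * v + 2 * v * ‖K‖) * ‖P ⟨s, hs'⟩ - P' ⟨s, hs'⟩‖ :=
          norm_riccatiSource_sub_le (by positivity) (norm_le_of_mem_positiveMinorants hv hV hP _)
            (norm_le_of_mem_positiveMinorants hv hV hP' _)
      _ ≤ (‖K‖ * v + 2 * v * ‖K‖) * (c * Real.exp (μ * (T - s))) := by
          gcongr
          exact hle _
      _ = 3 * ‖K‖ * v * c * Real.exp (μ * (T - s)) := by ring
  have factor_le : M ^ 2 * (3 * ‖K‖ * v * c) / μ ≤ c / 2 := by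
    rw [div_le_div_iff₀ ‹0 < μ› two_pos]
    linarith [mul_le_mul_of_nonneg_left hμ.le hc]
  refine (norm_lyapunovMap_sub_le (he.exp_smul _).toStarStronglyContinuous
    ((hP.1.iccExtend hT).riccatiSource Q K _) ((hP'.1.iccExtend hT).riccatiSource Q K _) t.2 hM
    (by positivity) ‹0 < μ› source_le).trans ?_
  gcongr

lemma exists_riccatiMap_fixedPoint (he : IsSemigroupFamily e) (hT : 0 ≤ T) (hG : G.IsPositive)
    (hQ : Q.IsPositive) (hK : K.IsPositive) :
    ∃ lam, ∃ P : Icc 0 T → H →L[ℝ] H, StronglyContinuous P ∧ (∀ t, (P t).IsPositive) ∧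
      riccatiMap e hT G Q K lam P = P := by
  let V := lyapunovMap e T G fun _ => Q
  have V_cont : StronglyContinuous V :=
    stronglyContinuous_lyapunovMap he.toStarStronglyContinuous (.const Q)
  obtain ⟨v, hv, V_le⟩ := V_cont.exists_norm_le (isCompact_Icc (a := 0) (b := T))
  obtain ⟨M, -, hM⟩ := (he.exp_smul (-(‖K‖ * v / 2))).apply.exists_norm_le
    (isCompact_Icc (a := 0) (b := T))
  obtain ⟨μ, hμ⟩ := exists_gt (6 * M ^ 2 * ‖K‖ * v)
  have : 0 < μ := lt_of_le_of_lt (by positivity) hμ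
  have maps := mapsTo_riccatiMap (hT := hT) he hG hQ hK hv V_le
  have V_mem : (fun t : Icc 0 T => V t) ∈ positiveMinorants T V :=
    ⟨V_cont.comp_continuous continuous_subtype_val, fun t =>
      ⟨isPositive_lyapunovMap he.toStarStronglyContinuous (.const Q) t.2.2 hG fun _ _ => hQ,
        le_rfl⟩⟩
  have first_step : ∀ t : Icc 0 T, ‖V t - riccatiMap e hT G Q K (‖K‖ * v) (fun t => V t) t‖
      ≤ 2 * v * Real.exp (μ * (T - t)) := fun t => by
    have : 0 ≤ T - t := sub_nonneg.2 t.2.2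
    calc _ ≤ v + v := norm_sub_le_of_le (V_le t t.2)
          (norm_le_of_mem_positiveMinorants hv V_le (maps V_mem) t)
      _ = 2 * v * 1 := by ring
      _ ≤ 2 * v * Real.exp (μ * (T - t)) := by
          gcongr
          exact Real.one_le_exp (by positivity)
  obtain ⟨P, hP, fixed⟩ := exists_fixedPoint_of_weighted_contraction (W := Real.exp (μ * T))
    (w := fun t : Icc 0 T => Real.exp (μ * (T - t)))
    (fun t => by gcongr; linarith [t.2.1]) maps
    (fun F hF F' hF' c hc hle => norm_riccatiMap_sub_le he hv V_le hM hμ hF hF' hc hle)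
    V_mem (by positivity) first_step
    (fun u hu F hF => mem_positiveMinorants_of_tendstoUniformly hu hF)
  exact ⟨‖K‖ * v, P, hP.1, fun t => (hP.2 t).1, fixed⟩

theorem exists_isPositive_eq_lyapunovMap (he : IsSemigroupFamily e) (hT : 0 ≤ T)
    (hG : G.IsPositive) (hQ : Q.IsPositive) (hK : K.IsPositive) :
    ∃ P : ℝ → H →L[ℝ] H, StronglyContinuous P ∧ (∀ t, (P t).IsPositive) ∧
      ∀ t ∈ Icc 0 T, P t = lyapunovMap e T G (fun s => Q - P s ∘L K ∘L P s) t := by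
  obtain ⟨lam, P, P_cont, P_pos, fixed⟩ := exists_riccatiMap_fixedPoint he hT hG hQ hK
  let P' : ℝ → H →L[ℝ] H := IccExtend hT P
  have P'_cont : StronglyContinuous P' := P_cont.iccExtend hT
  refine ⟨P', P'_cont, fun t => P_pos _, ?_⟩
  let e' : ℝ → H →L[ℝ] H := fun t => Real.exp (-(lam / 2) * t) • e t
  let h : ℝ → H →L[ℝ] H := fun s => riccatiSource Q K lam (P' s)
  have he' : IsSemigroupFamily e' := he.exp_smul _
  have h_cont : StronglyContinuous h := P'_cont.riccatiSource Q K lam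
  have W_cont := stronglyContinuous_lyapunovMap (T := T) (G := G) he'.toStarStronglyContinuous
    h_cont
  have P'_eq : ∀ t ∈ Icc 0 T, P' t = lyapunovMap e' T G h t := fun t ht =>
    (IccExtend_of_mem hT P ht).trans (congrFun fixed ⟨t, ht⟩).symm
  have e_eq : (fun t => Real.exp (-(-lam / 2) * t) • e' t) = e := funext fun t => by
    rw [smul_smul, ← Real.exp_add]
    ring_nf
    simp
  intro t ht
  rw [P'_eq t ht, ← lyapunovMap_exp_smul he' h_cont (-lam) ht.2, e_eq]
  refine lyapunovMap_congr he.toStarStronglyContinuous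
    (h_cont.add (W_cont.smul continuous_const))
    ((StronglyContinuous.const Q).sub (P'_cont.comp ((StronglyContinuous.const K).comp P'_cont)))
    ht.2 fun s hs => ?_
  rw [← P'_eq s ⟨ht.1.trans hs.1, hs.2⟩]
  simp only [h, riccatiSource]
  module

end Riccati

section Existence

lemma isPositive_inverse {U : Type*} [NormedAddCommGroup U] [InnerProductSpace ℝ U]
    {R : U →L[ℝ] U} (hR : R.IsPositive) : R.inverse.IsPositive := by
  by_cases invertible : R.IsInvertible
  · obtain ⟨f, rfl⟩ := invertible
    rw [ContinuousLinearMap.inverse_equiv, ContinuousLinearMap.isPositive_iff]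
    refine ⟨fun x y => ?_, fun x => ?_⟩
    · simpa using (hR.inner_left_eq_inner_right (f.symm x) (f.symm y)).symm
    · simpa using hR.inner_nonneg_right (f.symm x)
  · rw [ContinuousLinearMap.inverse_of_not_isInvertible invertible]
    exact ContinuousLinearMap.isPositive_zero

variable {H K U : Type*}
  [NormedAddCommGroup H] [InnerProductSpace ℝ H] [CompleteSpace H]
  [NormedAddCommGroup K] [InnerProductSpace ℝ K]
  [NormedAddCommGroup U] [InnerProductSpace ℝ U] [CompleteSpace U]
  {D : Coefficients H K U} {T : ℝ}

namespace Coefficients.Standing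

lemma isSemigroupFamily (hD : D.Standing) : IsSemigroupFamily fun t => D.expA (max t 0) where
  apply := hD.semigroup.stronglyContinuous_max
  adjoint_apply := hD.semigroup.adjoint.stronglyContinuous_max
  zero := by simp [hD.semigroup.zero]
  add s t hs ht := by
    rw [max_eq_left hs, max_eq_left ht, max_eq_left (by positivity), hD.semigroup.add s t hs ht]

lemma isPositive_R (hD : D.Standing) : D.R.IsPositive := by
  obtain ⟨ε, hε, coercive⟩ := hD.R_coercive
  rw [ContinuousLinearMap.isPositive_iff]
  exact ⟨hD.R_selfAdjoint.isSymmetric, fun α =>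
    le_trans (by positivity : 0 ≤ ε * ‖α‖ ^ 2) (coercive α)⟩

lemma isPositive_BRB (hD : D.Standing) : D.BRB.IsPositive :=
  (isPositive_inverse hD.isPositive_R).conj_adjoint D.B

theorem exists_isMildRiccati (hD : D.Standing) (hT : 0 ≤ T) :
    ∃ P : ℝ → H →L[ℝ] H, StronglyContinuous P ∧ (∀ t, (P t).IsPositive) ∧
      D.IsMildRiccati T P := by
  have he := hD.isSemigroupFamily
  obtain ⟨P, P_cont, P_pos, P_eq⟩ := exists_isPositive_eq_lyapunovMap he hT hD.QT_add_QbarT_pos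
    hD.Q_add_Qbar_pos hD.isPositive_BRB
  refine ⟨P, P_cont, P_pos, ⟨fun t _ => P_pos t, fun x => (P_cont x).continuousOn⟩,
    fun x t ht => ?_⟩
  have const_cont : StronglyContinuous fun _ : ℝ => D.Q + D.Qbar := .const _
  have quadratic_cont := P_cont.comp ((StronglyContinuous.const D.BRB).comp P_cont)
  have max_eq : ∀ s, t ≤ s → max (s - t) 0 = s - t := fun s hs => max_eq_left (sub_nonneg.2 hs)
  rw [P_eq t ht, lyapunovMap_apply he.toStarStronglyContinuous (const_cont.sub quadratic_cont),
    add_sub_assoc]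
  simp only [_root_.sub_apply, map_sub, max_eq T ht.2]
  congr 1
  refine (intervalIntegral.integral_sub ((he.conj_sub const_cont t x).intervalIntegrable _ _)
    ((he.conj_sub quadratic_cont t x).intervalIntegrable _ _)).trans ?_
  congr 1 <;> refine intervalIntegral.integral_congr fun s hs => ?_ <;>
    · rw [uIcc_of_le ht.2] at hs
      simp only [max_eq s hs.1]
      rfl

end Coefficients.Standing

end Existence

section LinearODE

variable {Y : Type*} [NormedAddCommGroup Y] {T : ℝ}

lemma norm_le_mul_exp_of_le_add_integral {z : ℝ → Y} {b k : ℝ} (hz : Continuous z) (hb : 0 ≤ b)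
    (hk : 0 ≤ k) (hle : ∀ t ∈ Icc 0 T, ‖z t‖ ≤ b + k * ∫ s in (0 : ℝ)..t, ‖z s‖) :
    ∀ t ∈ Icc 0 T, ‖z t‖ ≤ b * Real.exp (k * t) := by
  intro t ht
  let f : ℝ → ℝ := fun t => b + k * ∫ s in (0 : ℝ)..t, ‖z s‖
  have f_deriv : ∀ t, HasDerivAt f (k * ‖z t‖) t := fun t =>
    ((hz.norm.integral_hasStrictDerivAt 0 t).hasDerivAt.const_mul k).const_add b
  have deriv_le : ∀ s ∈ Ico 0 T, ‖k * ‖z s‖‖ ≤ k * ‖f s‖ + 0 := fun s hs => by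
    rw [norm_mul, norm_norm, Real.norm_of_nonneg hk, add_zero]
    exact mul_le_mul_of_nonneg_left ((hle s ⟨hs.1, hs.2.le⟩).trans (le_abs_self _)) hk
  calc ‖z t‖ ≤ ‖f t‖ := (hle t ht).trans (le_abs_self _)
    _ ≤ gronwallBound b k 0 (t - 0) := norm_le_gronwallBound_of_norm_deriv_right_le
        (fun s _ => (f_deriv s).continuousAt.continuousWithinAt)
        (fun s _ => (f_deriv s).hasDerivWithinAt)
        (by simp [f, abs_of_nonneg hb]) deriv_le t ht
    _ = b * Real.exp (k * t) := by rw [gronwallBound_ε0, sub_zero]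

variable [NormedSpace ℝ Y] [CompleteSpace Y] {a : ℝ → Y →L[ℝ] Y} {M : ℝ}

lemma norm_integral_apply_sub_le (ha : StronglyContinuous a) (hM : 0 < M)
    (haM : ∀ s ∈ Icc 0 T, ‖a s‖ ≤ M) {z z' : ℝ → Y} (hz : Continuous z) (hz' : Continuous z')
    {c : ℝ} (hc : 0 ≤ c) (hle : ∀ s ∈ Icc 0 T, ‖z s - z' s‖ ≤ c * Real.exp (2 * M * s)) {t : ℝ}
    (ht : t ∈ Icc 0 T) :
    ‖(∫ s in (0 : ℝ)..t, a s (z s)) - ∫ s in (0 : ℝ)..t, a s (z' s)‖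
      ≤ c / 2 * Real.exp (2 * M * t) := by
  rw [← intervalIntegral.integral_sub ((ha.continuous_apply hz).intervalIntegrable _ _)
    ((ha.continuous_apply hz').intervalIntegrable _ _)]
  have factor_eq : M * c / (2 * M) = c / 2 := by field_simp
  rw [← factor_eq]
  refine norm_integral_le_exp_forward ht.1 (by positivity) (by positivity) fun s hs => ?_
  have hs' : s ∈ Icc 0 T := ⟨hs.1, hs.2.trans ht.2⟩
  rw [← map_sub, mul_assoc]
  exact (a s).le_of_opNorm_le_of_le (haM s hs') (hle s hs')

theorem exists_linear_ode_solution (ha : StronglyContinuous a) (hT : 0 ≤ T) (z₀ : Y) :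
    ∃ z : ℝ → Y, Continuous z ∧ z 0 = z₀ ∧
      ∀ t ∈ Icc 0 T, HasDerivWithinAt z (a t (z t)) (Icc 0 T) t := by
  obtain ⟨M, hM, a_le⟩ := ha.exists_norm_le (isCompact_Icc (a := 0) (b := T))
  let Φ : (Icc 0 T → Y) → ℝ → Y := fun z t => z₀ + ∫ s in (0 : ℝ)..t, a s (IccExtend hT z s)
  have Φ_deriv : ∀ {z}, Continuous z → ∀ t, HasDerivAt (Φ z) (a t (IccExtend hT z t)) t :=
    fun hz t => ((ha.continuous_apply hz.Icc_extend').integral_hasStrictDerivAt 0 t).hasDerivAt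
      |>.const_add z₀
  have Φ_cont : ∀ {z}, Continuous z → Continuous (Φ z) := fun hz =>
    continuous_iff_continuousAt.2 fun t => (Φ_deriv hz t).continuousAt
  let z₁ : Icc 0 T → Y := fun _ => z₀
  have maps : MapsTo (fun z (t : Icc 0 T) => Φ z t) {z | Continuous z} {z | Continuous z} :=
    fun z hz => (Φ_cont hz).comp continuous_subtype_val
  obtain ⟨C, hC⟩ := isCompact_Icc.exists_bound_of_continuousOn (s := Icc 0 T)
    (Φ_cont (z := z₁) continuous_const).continuousOn
  obtain ⟨z, hz, fixed⟩ := exists_fixedPoint_of_weighted_contraction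
    (w := fun t : Icc 0 T => Real.exp (2 * M * t)) (W := Real.exp (2 * M * T)) (F₀ := z₁)
    (c₀ := ‖z₀‖ + |C|) (fun t => by gcongr; exact t.2.2) maps
    (fun z hz z' hz' c hc hle t => by
      rw [add_sub_add_left_eq_sub]
      refine norm_integral_apply_sub_le ha hM a_le hz.Icc_extend' hz'.Icc_extend' hc
        (fun s hs => ?_) t.2
      rw [IccExtend_of_mem hT z hs, IccExtend_of_mem hT z' hs]
      exact hle ⟨s, hs⟩)
    continuous_const (by positivity)
    (fun t => (norm_sub_le_of_le le_rfl ((hC t t.2).trans (le_abs_self C))).trans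
      (le_mul_of_one_le_right (by positivity) (Real.one_le_exp (mul_nonneg (by positivity) t.2.1))))
    (fun u hu F hF => hF.continuous (Frequently.of_forall hu))
  have extend_eq : ∀ t ∈ Icc 0 T, IccExtend hT z t = Φ z t := fun t ht =>
    (IccExtend_of_mem hT z ht).trans (congrFun fixed ⟨t, ht⟩).symm
  refine ⟨Φ z, Φ_cont hz, by simp [Φ], fun t ht => ?_⟩
  rw [← extend_eq t ht]
  exact (Φ_deriv hz t).hasDerivWithinAt

lemma stronglyContinuous_exp_smul (L : Y →L[ℝ] Y) :
    StronglyContinuous fun s : ℝ => NormedSpace.exp (s • L) := fun _ =>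
  (continuous_iff_continuousAt.2 fun s => (hasDerivAt_exp_smul_const L s).continuousAt).clm_apply
    continuous_const

lemma integral_exp_smul_apply {L : Y →L[ℝ] Y} {z v : ℝ → Y} (hv : Continuous v)
    (hz : ∀ t ∈ Icc 0 T, HasDerivWithinAt z (L (z t) + v t) (Icc 0 T) t) {p q : ℝ} (hp : 0 ≤ p)
    (hpq : p ≤ q) (hq : q ≤ T) (t : ℝ) :
    ∫ s in p..q, NormedSpace.exp ((t - s) • L) (v s)
      = NormedSpace.exp ((t - q) • L) (z q) - NormedSpace.exp ((t - p) • L) (z p) := by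
  have exp_deriv : ∀ s, HasDerivAt (fun s => NormedSpace.exp ((t - s) • L))
      (-(NormedSpace.exp ((t - s) • L) * L)) s := fun s =>
    (hasDerivAt_exp_smul_const L (t - s)).comp_const_sub t s
  have exp_cont : StronglyContinuous fun s => NormedSpace.exp ((t - s) • L) :=
    (stronglyContinuous_exp_smul L).comp_continuous (by fun_prop)
  have path_deriv : ∀ s ∈ Icc p q, HasDerivWithinAt (fun s => NormedSpace.exp ((t - s) • L) (z s))
      (NormedSpace.exp ((t - s) • L) (v s)) (Icc p q) s := fun s hs => by
    refine ((exp_deriv s).hasDerivWithinAt.clm_apply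
      ((hz s ⟨hp.trans hs.1, hs.2.trans hq⟩).mono (Icc_subset_Icc hp hq))).congr_deriv ?_
    rw [map_add, _root_.neg_apply, mul_apply_eq_comp]
    abel
  exact intervalIntegral.integral_eq_sub_of_hasDeriv_right_of_le hpq
    (fun s hs => (path_deriv s hs).continuousWithinAt)
    (fun s hs => ((path_deriv s ⟨hs.1.le, hs.2.le⟩).hasDerivAt
      (Icc_mem_nhds hs.1 hs.2)).hasDerivWithinAt)
    ((exp_cont.continuous_apply hv).intervalIntegrable _ _)

lemma StronglyContinuous.hasDerivWithinAt_apply {F : ℝ → Y →L[ℝ] Y} (hF : StronglyContinuous F)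
    {z : ℝ → Y} {s : Set ℝ} {t : ℝ} {w z' : Y}
    (hw : HasDerivWithinAt (fun u => F u (z t)) w s t) (hz : HasDerivWithinAt z z' s t) :
    HasDerivWithinAt (fun u => F u (z u)) (w + F t z') s t := by
  rw [hasDerivWithinAt_iff_tendsto_slope] at *
  have slope_tendsto : Tendsto (fun u => F u (slope z t u)) (𝓝[s \ {t}] t) (𝓝 (F t z')) :=
    (hF.continuous_uncurry.tendsto (t, z')).comp
      ((tendsto_id.mono_left nhdsWithin_le_nhds).prodMk_nhds hz)
  refine (hw.add slope_tendsto).congr fun u => ?_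
  simp only [slope_def_module, map_smul, map_sub, ← smul_add]
  congr 1
  abel

end LinearODE

section Approximation

variable {H K U : Type*}
  [NormedAddCommGroup H] [InnerProductSpace ℝ H] [CompleteSpace H]
  [NormedAddCommGroup K] [InnerProductSpace ℝ K]
  [NormedAddCommGroup U] [InnerProductSpace ℝ U] [CompleteSpace U]

namespace Coefficients

/-- The coefficients `D` with `e^{tA}` replaced by `E t`, for which the mild equations are to be
considered; the field for the operator `A`, which does not occur in them, is left as it is. -/
def withSemigroup (D : Coefficients H K U) (E : ℝ → H →L[ℝ] H) : Coefficients H K U :=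
  { D with expA := E }

/-- A strict solution of the forward-backward system whose generator is the bounded operator `L`. -/
structure IsStrictForwardBackward (D : Coefficients H K U) (T : ℝ) (z₀ : H) (P : ℝ → H →L[ℝ] H)
    (L : H →L[ℝ] H) (z r : ℝ → H) : Prop where
  continuous_z : Continuous z
  continuous_r : Continuous r
  initial : z 0 = z₀
  terminal : r T = -(D.QbarT (D.ST (z T)))
  hasDeriv_z : ∀ t ∈ Icc 0 T,
    HasDerivWithinAt z (L (z t) + -(D.BRB (P t (z t)) + D.BRB (r t))) (Icc 0 T) t
  hasDeriv_r : ∀ t ∈ Icc 0 T,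
    HasDerivWithinAt r ((-(L†)) (r t) + (P t (D.BRB (r t)) + D.Qbar (D.S (z t)))) (Icc 0 T) t

variable {D : Coefficients H K U} {T : ℝ} {z₀ : H} {P η : ℝ → H →L[ℝ] H} {L : H →L[ℝ] H}
  {z r : ℝ → H}

theorem IsStrictRiccati.exists_isStrictForwardBackward (hη : D.IsStrictRiccati T P L η)
    (hT : 0 ≤ T) (hP : StronglyContinuous P) (z₀ : H) :
    ∃ z r, D.IsStrictForwardBackward T z₀ P L z r ∧ ∀ t ∈ Icc 0 T, r t = η t (z t) := by
  let ζ : ℝ → H →L[ℝ] H := fun t => η (projIcc 0 T hT t)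
  have ζ_eq : ∀ t ∈ Icc 0 T, ζ t = η t := fun t ht => by
    simp only [ζ, projIcc_of_mem hT ht]
  have ζ_cont : StronglyContinuous ζ := fun x =>
    (show ContinuousOn (fun t => η t x) (Icc 0 T) from fun t ht =>
      (hη.hasDeriv t ht x).continuousWithinAt).comp_continuous
      (continuous_subtype_val.comp continuous_projIcc) fun t => (projIcc 0 T hT t).2
  obtain ⟨z, z_cont, z_zero, z_ode⟩ := exists_linear_ode_solution
    ((StronglyContinuous.const L).sub ((StronglyContinuous.const D.BRB).comp (hP.add ζ_cont)))
    hT z₀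
  have z_deriv : ∀ t ∈ Icc 0 T,
      HasDerivWithinAt z (L (z t) + -(D.BRB (P t (z t)) + D.BRB (ζ t (z t)))) (Icc 0 T) t :=
    fun t ht => (z_ode t ht).congr_deriv (by simp; abel)
  refine ⟨z, fun t => ζ t (z t), ⟨z_cont, ζ_cont.continuous_apply z_cont, z_zero, ?_, z_deriv,
    fun t ht => ?_⟩, fun t ht => by simp only [ζ_eq t ht]⟩
  · rw [ζ_eq T ⟨hT, le_rfl⟩, hη.terminal]
    rfl
  · have ζ_deriv : HasDerivWithinAt (fun u => ζ u (z t)) _ (Icc 0 T) t :=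
      (hη.hasDeriv t ht (z t)).congr (fun u hu => by rw [ζ_eq u hu]) (by rw [ζ_eq t ht])
    refine (ζ_cont.hasDerivWithinAt_apply ζ_deriv (z_deriv t ht)).congr_deriv ?_
    simp only [ζ_eq t ht, map_add, map_sub, map_neg, _root_.neg_apply]
    abel

lemma IsStrictForwardBackward.z_eq (h : D.IsStrictForwardBackward T z₀ P L z r)
    (hP : StronglyContinuous P) {t : ℝ} (ht : t ∈ Icc 0 T) :
    z t = NormedSpace.exp (t • L) z₀
      - (∫ s in (0 : ℝ)..t, NormedSpace.exp ((t - s) • L) (D.BRB (P s (z s))))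
      - ∫ s in (0 : ℝ)..t, NormedSpace.exp ((t - s) • L) (D.BRB (r s)) := by
  have exp_cont : StronglyContinuous fun s => NormedSpace.exp ((t - s) • L) :=
    (stronglyContinuous_exp_smul L).comp_continuous (by fun_prop)
  have Pz_cont : Continuous fun s => D.BRB (P s (z s)) :=
    D.BRB.continuous.comp (hP.continuous_apply h.continuous_z)
  have r_cont : Continuous fun s => D.BRB (r s) := D.BRB.continuous.comp h.continuous_r
  have duhamel := integral_exp_smul_apply
    (v := fun s => -(D.BRB (P s (z s)) + D.BRB (r s))) (Pz_cont.add r_cont).neg h.hasDeriv_z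
    le_rfl ht.1 ht.2 t
  simp only [map_neg, map_add, intervalIntegral.integral_neg, sub_self, zero_smul,
    NormedSpace.exp_zero, sub_zero, one_apply_eq_self, h.initial] at duhamel
  rw [intervalIntegral.integral_add ((exp_cont.continuous_apply Pz_cont).intervalIntegrable _ _)
    ((exp_cont.continuous_apply r_cont).intervalIntegrable _ _)] at duhamel
  linear_combination (norm := module) -duhamel

lemma adjoint_exp_smul (L : H →L[ℝ] H) (s : ℝ) :
    (NormedSpace.exp (s • L))† = NormedSpace.exp (s • L†) := by
  rw [← ContinuousLinearMap.star_eq_adjoint, NormedSpace.star_exp, star_smul, star_trivial,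
    ContinuousLinearMap.star_eq_adjoint]

lemma IsStrictForwardBackward.r_eq (h : D.IsStrictForwardBackward T z₀ P L z r)
    (hP : StronglyContinuous P) {t : ℝ} (ht : t ∈ Icc 0 T) :
    r t = ((NormedSpace.exp ((T - t) • L))†) (-(D.QbarT (D.ST (z T))))
      - (∫ s in t..T, ((NormedSpace.exp ((s - t) • L))†) (P s (D.BRB (r s))))
      - ∫ s in t..T, ((NormedSpace.exp ((s - t) • L))†) (D.Qbar (D.S (z s))) := by
  have exp_cont : StronglyContinuous fun s => NormedSpace.exp ((s - t) • L†) :=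
    (stronglyContinuous_exp_smul (L†)).comp_continuous (by fun_prop)
  have Pr_cont : Continuous fun s => P s (D.BRB (r s)) :=
    hP.continuous_apply (D.BRB.continuous.comp h.continuous_r)
  have Sz_cont : Continuous fun s => D.Qbar (D.S (z s)) :=
    D.Qbar.continuous.comp (D.S.continuous.comp h.continuous_z)
  have duhamel := integral_exp_smul_apply
    (v := fun s => P s (D.BRB (r s)) + D.Qbar (D.S (z s))) (Pr_cont.add Sz_cont) h.hasDeriv_r
    ht.1 ht.2 le_rfl t
  have reverse : ∀ s, (t - s) • -(L†) = (s - t) • L† := fun s => by module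
  simp only [reverse, map_add, sub_self, zero_smul, NormedSpace.exp_zero, one_apply_eq_self,
    h.terminal] at duhamel
  rw [intervalIntegral.integral_add ((exp_cont.continuous_apply Pr_cont).intervalIntegrable _ _)
    ((exp_cont.continuous_apply Sz_cont).intervalIntegrable _ _)] at duhamel
  simp only [adjoint_exp_smul]
  linear_combination (norm := module) duhamel

theorem IsStrictForwardBackward.isMildForwardBackward
    (h : D.IsStrictForwardBackward T z₀ P L z r) (hP : StronglyContinuous P) :
    (D.withSemigroup fun t => NormedSpace.exp (t • L)).IsMildForwardBackward T z₀ P z r where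
  continuousOn_z := h.continuous_z.continuousOn
  continuousOn_r := h.continuous_r.continuousOn
  z_eq _ ht := h.z_eq hP ht
  r_eq _ ht := h.r_eq hP ht

lemma IsMildForwardBackward.norm_z_le {E : ℝ → H →L[ℝ] H}
    (h : (D.withSemigroup E).IsMildForwardBackward T z₀ P z r) (hz : Continuous z) {c p C : ℝ}
    (hp : 0 ≤ p) (hC : 0 ≤ C) (hE : ∀ t ∈ Icc 0 T, ‖E t‖ ≤ c) (hP : ∀ t ∈ Icc 0 T, ‖P t‖ ≤ p)
    (hr : ∀ t ∈ Icc 0 T, ‖r t‖ ≤ C * ‖z t‖) :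
    ∀ t ∈ Icc 0 T, ‖z t‖ ≤ c * ‖z₀‖ * Real.exp (c * ‖D.BRB‖ * (p + C) * t) := by
  intro t ht
  have c_nonneg : 0 ≤ c := (norm_nonneg _).trans (hE t ht)
  have integral_le : ∀ {u : ℝ → H} {k : ℝ}, (∀ s ∈ Icc 0 T, ‖u s‖ ≤ k * ‖z s‖) → ∀ t ∈ Icc 0 T,
      ‖∫ s in (0 : ℝ)..t, E (t - s) (D.BRB (u s))‖
        ≤ c * ‖D.BRB‖ * k * ∫ s in (0 : ℝ)..t, ‖z s‖ := by
    intro u k hu t ht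
    rw [← intervalIntegral.integral_const_mul]
    refine intervalIntegral.norm_integral_le_of_norm_le ht.1 (.of_forall fun s hs => ?_)
      ((continuous_const.mul hz.norm).intervalIntegrable _ _)
    rw [mul_assoc, mul_assoc]
    exact (E (t - s)).le_of_opNorm_le_of_le
      (hE _ ⟨sub_nonneg.2 hs.2, by linarith [hs.1, ht.2]⟩)
      (D.BRB.le_opNorm_of_le (hu s ⟨hs.1.le, hs.2.trans ht.2⟩))
  refine norm_le_mul_exp_of_le_add_integral hz (by positivity) (by positivity) (fun t ht => ?_) t ht
  calc ‖z t‖ ≤ ‖E t z₀‖ + ‖∫ s in (0 : ℝ)..t, E (t - s) (D.BRB (P s (z s)))‖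
        + ‖∫ s in (0 : ℝ)..t, E (t - s) (D.BRB (r s))‖ := by
        rw [h.z_eq t ht]
        exact norm_sub_le_of_le (norm_sub_le _ _) le_rfl
    _ ≤ c * ‖z₀‖ + c * ‖D.BRB‖ * p * (∫ s in (0 : ℝ)..t, ‖z s‖)
        + c * ‖D.BRB‖ * C * ∫ s in (0 : ℝ)..t, ‖z s‖ :=
        add_le_add_three ((E t).le_of_opNorm_le (hE t ht) z₀)
          (integral_le (fun s hs => (P s).le_of_opNorm_le (hP s hs) _) t ht) (integral_le hr t ht)
    _ = c * ‖z₀‖ + c * ‖D.BRB‖ * (p + C) * ∫ s in (0 : ℝ)..t, ‖z s‖ := by ring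

theorem IsStrictRiccati.exists_isMildForwardBackward (hη : D.IsStrictRiccati T P L η)
    (hT : 0 ≤ T) (hP : StronglyContinuous P) (z₀ : H) {c p C : ℝ}
    (hL : ∀ t ∈ Icc 0 T, ‖NormedSpace.exp (t • L)‖ ≤ c) (hPp : ∀ t ∈ Icc 0 T, ‖P t‖ ≤ p)
    (hηC : ∀ t ∈ Icc 0 T, ‖η t‖ ≤ C) :
    ∃ z r, (D.withSemigroup fun t => NormedSpace.exp (t • L)).IsMildForwardBackward T z₀ P z r ∧
      ∀ t ∈ Icc 0 T, ‖z t‖ ≤ c * ‖z₀‖ * Real.exp (c * ‖D.BRB‖ * (p + C) * T) ∧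
        ‖r t‖ ≤ C * (c * ‖z₀‖ * Real.exp (c * ‖D.BRB‖ * (p + C) * T)) := by
  obtain ⟨z, r, strict, r_eq⟩ := hη.exists_isStrictForwardBackward hT hP z₀
  have zero_mem : (0 : ℝ) ∈ Icc 0 T := ⟨le_rfl, hT⟩
  have : 0 ≤ c := (norm_nonneg _).trans (hL 0 zero_mem)
  have p_nonneg : 0 ≤ p := (norm_nonneg _).trans (hPp 0 zero_mem)
  have C_nonneg : 0 ≤ C := (norm_nonneg _).trans (hηC 0 zero_mem)
  have r_le : ∀ t ∈ Icc 0 T, ‖r t‖ ≤ C * ‖z t‖ := fun t ht => by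
    rw [r_eq t ht]
    exact (η t).le_of_opNorm_le (hηC t ht) (z t)
  have mild := strict.isMildForwardBackward hP
  have z_le : ∀ t ∈ Icc 0 T, ‖z t‖ ≤ c * ‖z₀‖ * Real.exp (c * ‖D.BRB‖ * (p + C) * T) :=
    fun t ht => (mild.norm_z_le strict.continuous_z p_nonneg C_nonneg hL hPp r_le t ht).trans <| by
      gcongr
      exact ht.2
  exact ⟨z, r, mild, fun t ht => ⟨z_le t ht, (r_le t ht).trans
    (mul_le_mul_of_nonneg_left (z_le t ht) C_nonneg)⟩⟩

end Coefficients

end Approximation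

section WeakConvergence

theorem exists_subseq_tendsto_inner {X : Type*} [NormedAddCommGroup X] [InnerProductSpace ℝ X]
    [CompleteSpace X] {x : ℕ → X} {C : ℝ} (hx : ∀ n, ‖x n‖ ≤ C) :
    ∃ φ : ℕ → ℕ, StrictMono φ ∧ ∃ y : X, ∀ w : X,
      Tendsto (fun n => inner ℝ (x (φ n)) w) atTop (𝓝 (inner ℝ y w)) := by
  let V := (Submodule.span ℝ (range x)).topologicalClosure
  have : TopologicalSpace.SeparableSpace V :=
    (countable_range x).isSeparable.span.closure.separableSpace
  have mem_V : ∀ n, x n ∈ V := fun n =>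
    Submodule.le_topologicalClosure _ (Submodule.subset_span (mem_range_self n))
  have mem_ball : ∀ n, StrongDual.toWeakDual (InnerProductSpace.toDual ℝ V ⟨x n, mem_V n⟩) ∈
      WeakDual.toStrongDual ⁻¹' Metric.closedBall (0 : StrongDual ℝ V) C := fun n => 
    mem_closedBall_zero_iff.2 (((InnerProductSpace.toDual ℝ V).norm_map _).trans_le (hx n))
  obtain ⟨f, -, φ, hφ, hlim⟩ := WeakDual.isSeqCompact_closedBall ℝ V 0 C mem_ball
  let y := (InnerProductSpace.toDual ℝ V).symm (WeakDual.toStrongDual f)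
  have inner_eq : ∀ (v : V) (w : X), inner ℝ (v : X) w = inner ℝ v (V.orthogonalProjectionOnto w) :=
    fun v w => (Submodule.inner_orthogonalProjectionOnto_eq_of_mem_left v w).symm
  refine ⟨φ, hφ, y, fun w => ?_⟩
  rw [inner_eq, InnerProductSpace.toDual_symm_apply]
  have eval_tendsto :=
    ((WeakDual.eval_continuous (𝕜 := ℝ) (V.orthogonalProjectionOnto w)).tendsto f).comp hlim
  exact eval_tendsto.congr fun n => (inner_eq ⟨x (φ n), mem_V (φ n)⟩ w).symm

variable {α X : Type*} [MeasurableSpace α] {μ : Measure α} [NormedAddCommGroup X]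
  [InnerProductSpace ℝ X]

lemma tendsto_inner_sub_zero {x h : ℕ → X} {h₀ : X} {C : ℝ} (hx : ∀ n, ‖x n‖ ≤ C)
    (hh : Tendsto h atTop (𝓝 h₀)) :
    Tendsto (fun n => inner ℝ (x n) (h n - h₀)) atTop (𝓝 0) := by
  have bound_tendsto : Tendsto (fun n => C * ‖h n - h₀‖) atTop (𝓝 0) := by
    simpa using (tendsto_iff_norm_sub_tendsto_zero.1 hh).const_mul C
  exact squeeze_zero_norm (fun n => (norm_inner_le_norm _ _).trans
    (mul_le_mul_of_nonneg_right (hx n) (norm_nonneg _))) bound_tendsto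

lemma tendsto_inner_of_weak_of_strong {x h : ℕ → X} {x₀ h₀ : X} {C : ℝ} (hC : ∀ n, ‖x n‖ ≤ C)
    (hx : ∀ y, Tendsto (fun n => inner ℝ (x n) y) atTop (𝓝 (inner ℝ x₀ y)))
    (hh : Tendsto h atTop (𝓝 h₀)) :
    Tendsto (fun n => inner ℝ (x n) (h n)) atTop (𝓝 (inner ℝ x₀ h₀)) := by
  simpa [inner_sub_right] using (tendsto_inner_sub_zero hC hh).add (hx h₀)

lemma integrable_inner_of_memLp {f g : α → X} (hf : MemLp f 2 μ) (hg : MemLp g 2 μ) :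
    Integrable (fun a => inner ℝ (f a) (g a)) μ :=
  (hf.norm.integrable_mul hg.norm).mono' (hf.1.inner hg.1)
    (.of_forall fun a => norm_inner_le_norm (f a) (g a))

/-- Weak convergence in `L²(μ; X)` of an essentially bounded sequence `u` to `Z`. -/
structure WeaklyConverges (μ : Measure α) (u : ℕ → α → X) (Z : α → X) : Prop where
  aestronglyMeasurable : ∀ n, AEStronglyMeasurable (u n) μ
  exists_norm_le : ∃ C, ∀ n, ∀ᵐ a ∂μ, ‖u n a‖ ≤ C
  memLp : MemLp Z 2 μ
  tendsto : ∀ g : α → X, MemLp g 2 μ →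
    Tendsto (fun n => ∫ a, inner ℝ (u n a) (g a) ∂μ) atTop (𝓝 (∫ a, inner ℝ (Z a) (g a) ∂μ))

theorem exists_subseq_weaklyConverges [CompleteSpace X] [IsFiniteMeasure μ] {u : ℕ → α → X} {C : ℝ}
    (hu : ∀ n, AEStronglyMeasurable (u n) μ) (hC : ∀ n, ∀ᵐ a ∂μ, ‖u n a‖ ≤ C) :
    ∃ φ : ℕ → ℕ, StrictMono φ ∧ ∃ Z, WeaklyConverges μ (fun n => u (φ n)) Z := by
  have : Fact ((2 : ENNReal) ≠ ⊤) := ⟨by norm_num⟩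
  have u_memLp : ∀ n, MemLp (u n) 2 μ := fun n => .of_bound (hu n) C (hC n)
  have toLp_norm_le : ∀ n, ‖(u_memLp n).toLp‖ ≤ _ := fun n =>
    Lp.norm_le_of_ae_bound (abs_nonneg C) (by
      filter_upwards [(u_memLp n).coeFn_toLp, hC n] with a toLp_eq le
      rw [toLp_eq]
      exact le.trans (le_abs_self C))
  obtain ⟨φ, hφ, Z, hZ⟩ := exists_subseq_tendsto_inner toLp_norm_le
  refine ⟨φ, hφ, Z, fun n => hu (φ n), ⟨C, fun n => hC (φ n)⟩, Lp.memLp Z, fun g hg => ?_⟩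
  have inner_eq : ∀ {f : α → X} (hf : MemLp f 2 μ),
      inner ℝ hf.toLp hg.toLp = ∫ a, inner ℝ (f a) (g a) ∂μ := fun hf => by
    rw [L2.inner_def]
    refine integral_congr_ae ?_
    filter_upwards [hf.coeFn_toLp, hg.coeFn_toLp] with a hfa hga
    rw [hfa, hga]
  have Z_eq := inner_eq (Lp.memLp Z)
  rw [Lp.toLp_coeFn] at Z_eq
  simpa only [inner_eq, Z_eq] using hZ hg.toLp

namespace WeaklyConverges

variable {u : ℕ → α → X} {Z Z' : α → X}

lemma subseq (hu : WeaklyConverges μ u Z) {φ : ℕ → ℕ} (hφ : StrictMono φ) :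
    WeaklyConverges μ (fun n => u (φ n)) Z where
  aestronglyMeasurable n := hu.aestronglyMeasurable (φ n)
  exists_norm_le := hu.exists_norm_le.imp fun _ hC n => hC (φ n)
  memLp := hu.memLp
  tendsto g hg := (hu.tendsto g hg).comp hφ.tendsto_atTop

lemma mono_set {s t : Set α} (hu : WeaklyConverges (μ.restrict t) u Z) (hst : s ⊆ t)
    (hs : MeasurableSet s) : WeaklyConverges (μ.restrict s) u Z where
  aestronglyMeasurable n := (hu.aestronglyMeasurable n).mono_set hst
  exists_norm_le := hu.exists_norm_le.imp fun _ hC n =>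
    ae_restrict_of_ae_restrict_of_subset hst (hC n)
  memLp := hu.memLp.mono_measure (Measure.restrict_mono hst le_rfl)
  tendsto g hg := by
    have indicator_memLp : MemLp (s.indicator g) 2 (μ.restrict t) := by
      rw [memLp_indicator_iff_restrict hs, Measure.restrict_restrict_of_subset hst]
      exact hg
    have integral_eq : ∀ v : α → X, ∫ a in t, inner ℝ (v a) (s.indicator g a) ∂μ
        = ∫ a in s, inner ℝ (v a) (g a) ∂μ := fun v => by
      rw [← Measure.restrict_restrict_of_subset hst, ← integral_indicator hs]
      congr 1 with a
      by_cases ha : a ∈ s <;> simp [ha]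
    simpa only [integral_eq] using hu.tendsto _ indicator_memLp

lemma of_tendsto_inner [IsFiniteMeasure μ] (hu : ∀ n, AEStronglyMeasurable (u n) μ) {C : ℝ}
    (hC : ∀ n, ∀ᵐ a ∂μ, ‖u n a‖ ≤ C) (hZ : MemLp Z 2 μ)
    (hlim : ∀ᵐ a ∂μ, ∀ y, Tendsto (fun n => inner ℝ (u n a) y) atTop (𝓝 (inner ℝ (Z a) y))) :
    WeaklyConverges μ u Z where
  aestronglyMeasurable := hu
  exists_norm_le := ⟨C, hC⟩
  memLp := hZ
  tendsto g hg := by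
    refine tendsto_integral_of_dominated_convergence (fun a => C * ‖g a‖)
      (fun n => (hu n).inner hg.1) ((hg.integrable one_le_two).norm.const_mul C) (fun n => ?_) ?_
    · filter_upwards [hC n] with a ha
      exact (norm_inner_le_norm _ _).trans (mul_le_mul_of_nonneg_right ha (norm_nonneg _))
    · filter_upwards [hlim] with a ha using ha (g a)

lemma limit_unique (hZ : WeaklyConverges μ u Z) (hZ' : WeaklyConverges μ u Z') : Z =ᵐ[μ] Z' := by
  have diff_memLp : MemLp (Z - Z') 2 μ := hZ.memLp.sub hZ'.memLp
  have inner_eq := tendsto_nhds_unique (hZ.tendsto _ diff_memLp) (hZ'.tendsto _ diff_memLp)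
  have integral_eq_zero : ∫ a, inner ℝ ((Z - Z') a) ((Z - Z') a) ∂μ = 0 := by
    refine (integral_congr_ae (.of_forall fun a => inner_sub_left (Z a) (Z' a) _)).trans
      ((integral_sub (integrable_inner_of_memLp hZ.memLp diff_memLp)
        (integrable_inner_of_memLp hZ'.memLp diff_memLp)).trans ?_)
    rw [inner_eq, sub_self]
  filter_upwards [(integral_eq_zero_iff_of_nonneg (fun _ => real_inner_self_nonneg)
    (integrable_inner_of_memLp diff_memLp diff_memLp)).1 integral_eq_zero] with a ha
  exact sub_eq_zero.1 (inner_self_eq_zero.1 ha)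

lemma ae_eq_of_tendsto_inner {u : ℕ → ℝ → X} {Z f : ℝ → X} {a b : ℝ}
    (hu : WeaklyConverges (volume.restrict (Ioc a b)) u Z)
    (hf : ContinuousOn f (Icc a b))
    (hlim : ∀ t ∈ Icc a b, ∀ y, Tendsto (fun n => inner ℝ (u n t) y) atTop (𝓝 (inner ℝ (f t) y))) :
    Z =ᵐ[volume.restrict (Ioc a b)] f := by
  obtain ⟨C, hC⟩ := hu.exists_norm_le
  obtain ⟨C', hC'⟩ := isCompact_Icc.exists_bound_of_continuousOn hf
  have f_memLp : MemLp f 2 (volume.restrict (Ioc a b)) :=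
    .of_bound ((hf.mono Ioc_subset_Icc_self).aestronglyMeasurable measurableSet_Ioc) C'
      (ae_restrict_of_forall_mem measurableSet_Ioc fun t ht => hC' t (Ioc_subset_Icc_self ht))
  exact hu.limit_unique <| .of_tendsto_inner hu.aestronglyMeasurable hC f_memLp <|
    ae_restrict_of_forall_mem measurableSet_Ioc fun t ht => hlim t (Ioc_subset_Icc_self ht)

theorem tendsto_integral_inner [IsFiniteMeasure μ] (hu : WeaklyConverges μ u Z) {c : ℝ}
    {h : ℕ → α → X} {h₀ : α → X} (hh : ∀ n, AEStronglyMeasurable (h n) μ)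
    (hc : ∀ n, ∀ᵐ a ∂μ, ‖h n a‖ ≤ c) (hlim : ∀ᵐ a ∂μ, Tendsto (fun n => h n a) atTop (𝓝 (h₀ a))) :
    Tendsto (fun n => ∫ a, inner ℝ (u n a) (h n a) ∂μ) atTop
      (𝓝 (∫ a, inner ℝ (Z a) (h₀ a) ∂μ)) := by
  obtain ⟨C, hC⟩ := hu.exists_norm_le
  have h₀_meas : AEStronglyMeasurable h₀ μ := aestronglyMeasurable_of_tendsto_ae atTop hh hlim
  have h₀_le : ∀ᵐ a ∂μ, ‖h₀ a‖ ≤ c := by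
    filter_upwards [hlim, ae_all_iff.2 hc] with a ha hca using le_of_tendsto' ha.norm hca
  have h₀_memLp : MemLp h₀ 2 μ := .of_bound h₀_meas c h₀_le
  have u_memLp : ∀ n, MemLp (u n) 2 μ := fun n => .of_bound (hu.aestronglyMeasurable n) C (hC n)
  have h_memLp : ∀ n, MemLp (h n) 2 μ := fun n => .of_bound (hh n) c (hc n)
  have diff_tendsto : Tendsto (fun n => ∫ a, inner ℝ (u n a) (h n a - h₀ a) ∂μ) atTop
      (𝓝 (∫ _, (0 : ℝ) ∂μ)) := by
    refine tendsto_integral_of_dominated_convergence (fun _ => C * (c + c))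
      (fun n => (hu.aestronglyMeasurable n).inner ((hh n).sub h₀_meas)) (integrable_const _)
      (fun n => ?_) ?_
    · filter_upwards [hC n, hc n, h₀_le] with a hua hha hh₀a
      exact (norm_inner_le_norm _ _).trans (mul_le_mul hua (norm_sub_le_of_le hha hh₀a)
        (norm_nonneg _) ((norm_nonneg _).trans hua))
    · filter_upwards [ae_all_iff.2 hC, hlim] with a hua hha using tendsto_inner_sub_zero hua hha
  have sum_tendsto := diff_tendsto.add (hu.tendsto h₀ h₀_memLp)
  rw [integral_zero, zero_add] at sum_tendsto
  refine sum_tendsto.congr fun n => ?_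
  refine (integral_add (integrable_inner_of_memLp (u_memLp n) ((h_memLp n).sub h₀_memLp))
    (integrable_inner_of_memLp (u_memLp n) h₀_memLp)).symm.trans
    (integral_congr_ae (.of_forall fun a => ?_))
  simp only [Pi.sub_apply, ← inner_add_right, sub_add_cancel]

/- The inner product moves each operator onto the fixed vector `y`, where it converges strongly. -/
theorem tendsto_inner_integral_apply [CompleteSpace X] [IsFiniteMeasure μ]
    (hu : WeaklyConverges μ u Z) {k : ℕ → α → X →L[ℝ] X} {k₀ : α → X →L[ℝ] X} {c : ℝ} {y : X}
    (hk : ∀ n, Integrable (fun a => k n a (u n a)) μ) (hk₀ : Integrable (fun a => k₀ a (Z a)) μ)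
    (hmeas : ∀ n, AEStronglyMeasurable (fun a => ((k n a)†) y) μ)
    (hc : ∀ n, ∀ᵐ a ∂μ, ‖k n a‖ ≤ c)
    (hlim : ∀ᵐ a ∂μ, Tendsto (fun n => ((k n a)†) y) atTop (𝓝 (((k₀ a)†) y))) :
    Tendsto (fun n => inner ℝ (∫ a, k n a (u n a) ∂μ) y) atTop
      (𝓝 (inner ℝ (∫ a, k₀ a (Z a) ∂μ) y)) := by
  have inner_eq : ∀ {κ : α → X →L[ℝ] X} {v : α → X}, Integrable (fun a => κ a (v a)) μ →
      inner ℝ (∫ a, κ a (v a) ∂μ) y = ∫ a, inner ℝ (v a) (((κ a)†) y) ∂μ := fun h => by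
    simp only [real_inner_comm y, ← integral_inner h, ContinuousLinearMap.adjoint_inner_right]
  simp only [inner_eq hk₀, fun n => inner_eq (hk n)]
  refine hu.tendsto_integral_inner (c := c * ‖y‖) hmeas (fun n => ?_) hlim
  filter_upwards [hc n] with a ha
  exact ((k n a)†).le_of_opNorm_le (by rwa [LinearIsometryEquiv.norm_map]) y

end WeaklyConverges

end WeakConvergence

section Volterra

lemma StronglyContinuous.intervalIntegrable_apply {X Y : Type*} [NormedAddCommGroup X]
    [NormedSpace ℝ X] [CompleteSpace X] [NormedAddCommGroup Y] [NormedSpace ℝ Y]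
    {F : ℝ → X →L[ℝ] Y} (hF : StronglyContinuous F) {u : ℝ → X} {a b : ℝ}
    (hu : IntervalIntegrable u volume a b) :
    IntervalIntegrable (fun s => F s (u s)) volume a b := by
  obtain ⟨c, -, hc⟩ := hF.exists_norm_le (isCompact_uIcc (a := a) (b := b))
  rw [intervalIntegrable_iff] at *
  refine (hu.norm.const_mul c).mono' (hF.aestronglyMeasurable_apply hu.1) ?_
  filter_upwards [ae_restrict_mem measurableSet_uIoc] with s hs
  exact (F s).le_of_opNorm_le (hc s (uIoc_subset_uIcc hs)) (u s)

section Continuity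

variable {X : Type*} [NormedAddCommGroup X] [NormedSpace ℝ X] [CompleteSpace X] {T : ℝ}
  {L : ℝ → X →L[ℝ] X} {v : ℝ → X}

/- On `[0, T]` the kernel may be replaced by `F`, which is frozen outside `[0, T]`: then
`∫₀ᵗ F (t - s) v = ∫₀ᵀ F (t - s) v - ∫ₜᵀ F 0 v`, and the domain no longer moves with `F`. -/
lemma continuousOn_volterra_forward (hL : StronglyContinuous L) (hT : 0 ≤ T)
    (hv : IntervalIntegrable v volume 0 T) :
    ContinuousOn (fun t => ∫ s in (0 : ℝ)..t, L (t - s) (v s)) (Icc 0 T) := by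
  let F : ℝ → X →L[ℝ] X := fun t => L (projIcc 0 T hT t)
  have F_cont : StronglyContinuous F := hL.comp_continuous
    (continuous_subtype_val.comp continuous_projIcc)
  obtain ⟨c, -, hc⟩ := hL.exists_norm_le (isCompact_Icc (a := 0) (b := T))
  have F_le : ∀ t, ‖F t‖ ≤ c := fun t => hc _ (projIcc 0 T hT t).2
  have Fv_int : ∀ t, IntervalIntegrable (fun s => F (t - s) (v s)) volume 0 T := fun t =>
    (F_cont.comp_continuous (by fun_prop)).intervalIntegrable_apply hv
  have full_cont : Continuous fun t => ∫ s in (0 : ℝ)..T, F (t - s) (v s) :=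
    intervalIntegral.continuous_of_dominated_interval (bound := fun s => c * ‖v s‖)
      (fun t => (intervalIntegrable_iff.1 (Fv_int t)).1)
      (fun t => .of_forall fun s _ => (F _).le_of_opNorm_le (F_le _) _) (hv.norm.const_mul c)
      (.of_forall fun s _ => (F_cont (v s)).comp (by fun_prop))
  have F₀v_int : IntervalIntegrable (fun s => F 0 (v s)) volume 0 T :=
    (StronglyContinuous.const (F 0)).intervalIntegrable_apply hv
  have tail_cont : ContinuousOn (fun t => ∫ s in t..T, F 0 (v s)) (Icc 0 T) := by
    have := intervalIntegral.continuousOn_primitive_interval' F₀v_int right_mem_uIcc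
    rw [uIcc_of_le hT] at this
    exact this.neg.congr fun t _ => intervalIntegral.integral_symm _ _
  refine (full_cont.continuousOn.sub tail_cont).congr fun t ht => ?_
  have head_eq : ∫ s in (0 : ℝ)..t, L (t - s) (v s) = ∫ s in (0 : ℝ)..t, F (t - s) (v s) := by
    refine intervalIntegral.integral_congr fun s hs => ?_
    rw [uIcc_of_le ht.1] at hs
    simp only [F, projIcc_of_mem hT
      (show t - s ∈ Icc 0 T from ⟨sub_nonneg.2 hs.2, by linarith [hs.1, ht.2]⟩)]
  have tail_eq : ∫ s in t..T, F 0 (v s) = ∫ s in t..T, F (t - s) (v s) := by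
    refine intervalIntegral.integral_congr fun s hs => ?_
    rw [uIcc_of_le ht.2] at hs
    simp only [F, projIcc_of_le_left hT (sub_nonpos.2 hs.1), projIcc_left]
  have subinterval : uIcc 0 t ⊆ uIcc 0 T ∧ uIcc t T ⊆ uIcc 0 T := by
    simp only [uIcc_of_le, hT, ht.1, ht.2]
    exact ⟨Icc_subset_Icc_right ht.2, Icc_subset_Icc_left ht.1⟩
  rw [Pi.sub_apply, head_eq, tail_eq, eq_sub_iff_add_eq]
  exact intervalIntegral.integral_add_adjacent_intervals
    ((Fv_int t).mono_set subinterval.1) ((Fv_int t).mono_set subinterval.2)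

lemma continuousOn_volterra_backward (hL : StronglyContinuous L) (hT : 0 ≤ T)
    (hv : IntervalIntegrable v volume 0 T) :
    ContinuousOn (fun t => ∫ s in t..T, L (s - t) (v s)) (Icc 0 T) := by
  have reversed_int : IntervalIntegrable (fun s => v (T - s)) volume 0 T := by
    simpa using (hv.comp_sub_left T).symm
  refine ((continuousOn_volterra_forward hL hT reversed_int).comp
    (f := fun t => T - t) (by fun_prop)
    fun t ht => ⟨sub_nonneg.2 ht.2, sub_le_self T ht.1⟩).congr fun t _ => ?_
  have := intervalIntegral.integral_comp_sub_left (a := 0) (b := T - t)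
    (fun s => L (s - t) (v s)) T
  simp only [Function.comp_apply, sub_right_comm T t]
  simpa using this.symm

end Continuity

section StrongStar

variable {H : Type*} [NormedAddCommGroup H] [InnerProductSpace ℝ H] [CompleteSpace H]

/-- Pointwise convergence on the set of times `I`, in the strong-star topology, of a uniformly
bounded sequence of star-strongly continuous operator families. -/
structure TendstoStrongStar (I : Set ℝ) (E : ℕ → ℝ → H →L[ℝ] H) (e : ℝ → H →L[ℝ] H) : Prop where
  starStronglyContinuous : ∀ n, StarStronglyContinuous (E n)
  starStronglyContinuous_limit : StarStronglyContinuous e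
  exists_norm_le : ∃ c, ∀ n, ∀ t ∈ I, ‖E n t‖ ≤ c
  tendsto_apply : ∀ t ∈ I, ∀ x, Tendsto (fun n => E n t x) atTop (𝓝 (e t x))
  tendsto_adjoint_apply : ∀ t ∈ I, ∀ x, Tendsto (fun n => ((E n t)†) x) atTop (𝓝 (((e t)†) x))

namespace TendstoStrongStar

variable {I : Set ℝ} {E : ℕ → ℝ → H →L[ℝ] H} {e : ℝ → H →L[ℝ] H}

lemma subseq (hE : TendstoStrongStar I E e) {φ : ℕ → ℕ} (hφ : StrictMono φ) :
    TendstoStrongStar I (fun n => E (φ n)) e where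
  starStronglyContinuous n := hE.starStronglyContinuous (φ n)
  starStronglyContinuous_limit := hE.starStronglyContinuous_limit
  exists_norm_le := hE.exists_norm_le.imp fun _ hc n => hc (φ n)
  tendsto_apply t ht x := (hE.tendsto_apply t ht x).comp hφ.tendsto_atTop
  tendsto_adjoint_apply t ht x := (hE.tendsto_adjoint_apply t ht x).comp hφ.tendsto_atTop

lemma adjoint (hE : TendstoStrongStar I E e) :
    TendstoStrongStar I (fun n t => (E n t)†) fun t => (e t)† where
  starStronglyContinuous n := (hE.starStronglyContinuous n).adjoint
  starStronglyContinuous_limit := hE.starStronglyContinuous_limit.adjoint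
  exists_norm_le := by simpa only [LinearIsometryEquiv.norm_map] using hE.exists_norm_le
  tendsto_apply := hE.tendsto_adjoint_apply
  tendsto_adjoint_apply := by
    simpa only [ContinuousLinearMap.adjoint_adjoint] using hE.tendsto_apply

theorem tendsto_inner_integral (hE : TendstoStrongStar I E e) {Φ : ℝ → H →L[ℝ] H}
    (hΦ : StarStronglyContinuous Φ) {τ : ℝ → ℝ} (hτ : Continuous τ) {a b : ℝ} (hab : a ≤ b)
    (hτI : MapsTo τ (Ioc a b) I) {u : ℕ → ℝ → H} {Z : ℝ → H}
    (hu : WeaklyConverges (volume.restrict (Ioc a b)) u Z) (y : H) :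
    Tendsto (fun n => inner ℝ (∫ s in a..b, E n (τ s) (Φ s (u n s))) y) atTop
      (𝓝 (inner ℝ (∫ s in a..b, e (τ s) (Φ s (Z s))) y)) := by
  obtain ⟨c, hc⟩ := hE.exists_norm_le
  obtain ⟨C, hC⟩ := hu.exists_norm_le
  obtain ⟨p, -, hp⟩ := hΦ.apply.exists_norm_le (isCompact_Icc (a := a) (b := b))
  have kernel_cont : ∀ {F}, StarStronglyContinuous F →
      StarStronglyContinuous fun s => F (τ s) ∘L Φ s := fun hF =>
    (hF.comp_continuous hτ).comp hΦ
  have integrable : ∀ {F v}, StarStronglyContinuous F →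
      Integrable v (volume.restrict (Ioc a b)) →
      Integrable (fun s => F (τ s) (Φ s (v s))) (volume.restrict (Ioc a b)) := fun hF hv =>
    (intervalIntegrable_iff_integrableOn_Ioc_of_le hab).1 <|
      (kernel_cont hF).apply.intervalIntegrable_apply
        ((intervalIntegrable_iff_integrableOn_Ioc_of_le hab).2 hv)
  simp only [intervalIntegral.integral_of_le hab]
  refine hu.tendsto_inner_integral_apply (k := fun n s => E n (τ s) ∘L Φ s)
    (k₀ := fun s => e (τ s) ∘L Φ s) (c := c * p)
    (fun n => integrable (hE.starStronglyContinuous n)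
      (.of_bound (hu.aestronglyMeasurable n) C (hC n)))
    (integrable hE.starStronglyContinuous_limit (hu.memLp.integrable one_le_two))
    (fun n => ((kernel_cont (hE.starStronglyContinuous n)).adjoint_apply y).aestronglyMeasurable)
    (fun n => ?_) ?_
  · filter_upwards [ae_restrict_mem measurableSet_Ioc] with s hs
    exact (ContinuousLinearMap.opNorm_comp_le _ _).trans
      (mul_le_mul (hc n _ (hτI hs)) (hp s (Ioc_subset_Icc_self hs)) (norm_nonneg _)
        ((norm_nonneg _).trans (hc n _ (hτI hs))))
  · filter_upwards [ae_restrict_mem measurableSet_Ioc] with s hs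
    simp only [ContinuousLinearMap.adjoint_comp, ContinuousLinearMap.comp_apply]
    exact ((Φ s)†).continuous.continuousAt.tendsto.comp
      (hE.tendsto_adjoint_apply _ (hτI hs) y)

end TendstoStrongStar

end StrongStar

end Volterra

section Limit

variable {H K U : Type*}
  [NormedAddCommGroup H] [InnerProductSpace ℝ H] [CompleteSpace H]
  [NormedAddCommGroup K] [InnerProductSpace ℝ K]
  [NormedAddCommGroup U] [InnerProductSpace ℝ U] [CompleteSpace U]
  {D : Coefficients H K U} {T : ℝ} {z₀ : H} {P : ℝ → H →L[ℝ] H}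

namespace Coefficients

/-- The right-hand side of the mild equation for `z`. -/
noncomputable def forwardMap (D : Coefficients H K U) (z₀ : H) (P : ℝ → H →L[ℝ] H) (z r : ℝ → H)
    (t : ℝ) : H :=
  D.expA t z₀ - (∫ s in (0 : ℝ)..t, D.expA (t - s) (D.BRB (P s (z s))))
    - ∫ s in (0 : ℝ)..t, D.expA (t - s) (D.BRB (r s))

/-- The right-hand side of the mild equation for `r`. The terminal value `w` of `z` is a separate
argument, so that `z` only matters up to almost everywhere equality. -/
noncomputable def backwardMap (D : Coefficients H K U) (T : ℝ) (w : H) (P : ℝ → H →L[ℝ] H)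
    (z r : ℝ → H) (t : ℝ) : H :=
  D.expAdj (T - t) (-(D.QbarT (D.ST w)))
    - (∫ s in t..T, D.expAdj (s - t) (P s (D.BRB (r s))))
    - ∫ s in t..T, D.expAdj (s - t) (D.Qbar (D.S (z s)))

section Regularity

variable {z z' r r' : ℝ → H}

lemma forwardMap_congr (hz : z =ᵐ[volume.restrict (Ioc 0 T)] z')
    (hr : r =ᵐ[volume.restrict (Ioc 0 T)] r') {t : ℝ} (ht : t ∈ Icc 0 T) :
    D.forwardMap z₀ P z r t = D.forwardMap z₀ P z' r' t := by
  have restrict : ∀ {u v : ℝ → H}, u =ᵐ[volume.restrict (Ioc 0 T)] v →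
      u =ᵐ[volume.restrict (uIoc 0 t)] v := fun h =>
    ae_restrict_of_ae_restrict_of_subset (uIoc_of_le ht.1 ▸ Ioc_subset_Ioc_right ht.2) h
  unfold forwardMap
  congr 1
  · congr 1
    exact intervalIntegral.integral_congr_ae_restrict <| (restrict hz).mono fun s hs => by simp [hs]
  · exact intervalIntegral.integral_congr_ae_restrict <| (restrict hr).mono fun s hs => by simp [hs]

lemma backwardMap_congr (hz : z =ᵐ[volume.restrict (Ioc 0 T)] z')
    (hr : r =ᵐ[volume.restrict (Ioc 0 T)] r') (w : H) {t : ℝ} (ht : t ∈ Icc 0 T) :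
    D.backwardMap T w P z r t = D.backwardMap T w P z' r' t := by
  have restrict : ∀ {u v : ℝ → H}, u =ᵐ[volume.restrict (Ioc 0 T)] v →
      u =ᵐ[volume.restrict (uIoc t T)] v := fun h =>
    ae_restrict_of_ae_restrict_of_subset (uIoc_of_le ht.2 ▸ Ioc_subset_Ioc_left ht.1) h
  unfold backwardMap
  congr 1
  · congr 1
    exact intervalIntegral.integral_congr_ae_restrict <| (restrict hr).mono fun s hs => by simp [hs]
  · exact intervalIntegral.integral_congr_ae_restrict <| (restrict hz).mono fun s hs => by simp [hs]

lemma continuousOn_forwardMap (hE : StronglyContinuous D.expA) (hT : 0 ≤ T)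
    (hP : StronglyContinuous P) (hz : IntervalIntegrable z volume 0 T)
    (hr : IntervalIntegrable r volume 0 T) (z₀ : H) :
    ContinuousOn (D.forwardMap z₀ P z r) (Icc 0 T) :=
  ((hE z₀).continuousOn.sub (continuousOn_volterra_forward hE hT
    (((StronglyContinuous.const D.BRB).comp hP).intervalIntegrable_apply hz))).sub
    (continuousOn_volterra_forward hE hT
      ((StronglyContinuous.const D.BRB).intervalIntegrable_apply hr))

lemma continuousOn_backwardMap (hE : StronglyContinuous D.expAdj) (hT : 0 ≤ T)
    (hP : StronglyContinuous P) (hz : IntervalIntegrable z volume 0 T)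
    (hr : IntervalIntegrable r volume 0 T) (w : H) :
    ContinuousOn (D.backwardMap T w P z r) (Icc 0 T) :=
  (((hE _).comp (continuous_const.sub continuous_id)).continuousOn.sub
    (continuousOn_volterra_backward hE hT
      ((hP.comp (.const D.BRB)).intervalIntegrable_apply hr))).sub
    (continuousOn_volterra_backward hE hT
      ((StronglyContinuous.const (D.Qbar ∘L D.S)).intervalIntegrable_apply hz))

end Regularity

section WeakLimit

variable {E : ℕ → ℝ → H →L[ℝ] H} {e : ℝ → H →L[ℝ] H} {z r : ℕ → ℝ → H} {Z R : ℝ → H}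

theorem tendsto_inner_forwardMap (hE : TendstoStrongStar (Icc 0 T) E e)
    (hP : StarStronglyContinuous P) (hz : WeaklyConverges (volume.restrict (Ioc 0 T)) z Z)
    (hr : WeaklyConverges (volume.restrict (Ioc 0 T)) r R) {t : ℝ} (ht : t ∈ Icc 0 T) (y : H) :
    Tendsto (fun n => inner ℝ ((D.withSemigroup (E n)).forwardMap z₀ P (z n) (r n) t) y) atTop
      (𝓝 (inner ℝ ((D.withSemigroup e).forwardMap z₀ P Z R t) y)) := by
  have integral_tendsto : ∀ {Φ : ℝ → H →L[ℝ] H} {u : ℕ → ℝ → H} {V : ℝ → H},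
      StarStronglyContinuous Φ →
      WeaklyConverges (volume.restrict (Ioc 0 T)) u V →
      Tendsto (fun n => inner ℝ (∫ s in (0 : ℝ)..t, E n (t - s) (Φ s (u n s))) y) atTop
        (𝓝 (inner ℝ (∫ s in (0 : ℝ)..t, e (t - s) (Φ s (V s))) y)) := fun hΦ hu =>
    hE.tendsto_inner_integral hΦ (by fun_prop) ht.1
      (fun s hs => ⟨sub_nonneg.2 hs.2, by linarith [hs.1, ht.2]⟩)
      (hu.mono_set (Ioc_subset_Ioc_right ht.2) measurableSet_Ioc) y
  simp only [forwardMap, inner_sub_left]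
  refine (((hE.tendsto_apply t ht z₀).inner tendsto_const_nhds).sub ?_).sub ?_
  · exact integral_tendsto (Φ := fun s => D.BRB ∘L P s)
      ((StarStronglyContinuous.const _).comp hP) hz
  · exact integral_tendsto (Φ := fun _ => D.BRB) (.const _) hr

theorem tendsto_inner_backwardMap (hE : TendstoStrongStar (Icc 0 T) E e)
    (hP : StarStronglyContinuous P) (hz : WeaklyConverges (volume.restrict (Ioc 0 T)) z Z)
    (hr : WeaklyConverges (volume.restrict (Ioc 0 T)) r R) {w : ℕ → H} {w₀ : H} {C : ℝ}
    (hC : ∀ n, ‖w n‖ ≤ C) (hw : ∀ y, Tendsto (fun n => inner ℝ (w n) y) atTop (𝓝 (inner ℝ w₀ y)))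
    {t : ℝ} (ht : t ∈ Icc 0 T) (y : H) :
    Tendsto (fun n => inner ℝ ((D.withSemigroup (E n)).backwardMap T (w n) P (z n) (r n) t) y)
      atTop (𝓝 (inner ℝ ((D.withSemigroup e).backwardMap T w₀ P Z R t) y)) := by
  have integral_tendsto : ∀ {Φ : ℝ → H →L[ℝ] H} {u : ℕ → ℝ → H} {V : ℝ → H},
      StarStronglyContinuous Φ →
      WeaklyConverges (volume.restrict (Ioc 0 T)) u V →
      Tendsto (fun n => inner ℝ (∫ s in t..T, ((E n (s - t))†) (Φ s (u n s))) y) atTop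
        (𝓝 (inner ℝ (∫ s in t..T, ((e (s - t))†) (Φ s (V s))) y)) := fun hΦ hu =>
    hE.adjoint.tendsto_inner_integral hΦ (by fun_prop) ht.2
      (fun s hs => ⟨sub_nonneg.2 hs.1.le, by linarith [hs.2, ht.1]⟩)
      (hu.mono_set (Ioc_subset_Ioc_left ht.1) measurableSet_Ioc) y
  have terminal_eq : ∀ (L : H →L[ℝ] H) (x : H), inner ℝ ((L†) (-(D.QbarT (D.ST x)))) y
      = inner ℝ x (-(((D.QbarT ∘L D.ST)†) (L y))) := fun L x => by
    rw [ContinuousLinearMap.adjoint_inner_left, inner_neg_left, inner_neg_right,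
      ContinuousLinearMap.adjoint_inner_right, ContinuousLinearMap.comp_apply]
  have terminal_tendsto : Tendsto (fun n => inner ℝ (((E n (T - t))†) (-(D.QbarT (D.ST (w n))))) y)
      atTop (𝓝 (inner ℝ (((e (T - t))†) (-(D.QbarT (D.ST w₀)))) y)) := by
    simp only [terminal_eq]
    exact tendsto_inner_of_weak_of_strong hC hw
      ((((D.QbarT ∘L D.ST)†).continuous.tendsto _).comp
        (hE.tendsto_apply (T - t) ⟨sub_nonneg.2 ht.2, sub_le_self T ht.1⟩ y)).neg
  simp only [backwardMap, inner_sub_left]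
  refine (terminal_tendsto.sub ?_).sub ?_
  · exact integral_tendsto (Φ := fun s => P s ∘L D.BRB) (hP.comp (.const _)) hr
  · exact integral_tendsto (Φ := fun _ => D.Qbar ∘L D.S) (.const _) hz

theorem IsMildForwardBackward.exists_of_weaklyConverges
    (h : ∀ n, (D.withSemigroup (E n)).IsMildForwardBackward T z₀ P (z n) (r n)) (hT : 0 ≤ T)
    (hE : TendstoStrongStar (Icc 0 T) E e) (hP : StarStronglyContinuous P)
    (hZ : WeaklyConverges (volume.restrict (Ioc 0 T)) z Z)
    (hR : WeaklyConverges (volume.restrict (Ioc 0 T)) r R) {C : ℝ} (hC : ∀ n, ‖z n T‖ ≤ C) :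
    ∃ z r, (D.withSemigroup e).IsMildForwardBackward T z₀ P z r := by
  have he := hE.starStronglyContinuous_limit
  have integrable : ∀ {u : ℕ → ℝ → H} {V : ℝ → H},
      WeaklyConverges (volume.restrict (Ioc 0 T)) u V → IntervalIntegrable V volume 0 T :=
    fun hV =>
      (intervalIntegrable_iff_integrableOn_Ioc_of_le hT).2 (hV.memLp.integrable one_le_two)
  have right_mem : T ∈ Icc 0 T := ⟨hT, le_rfl⟩
  let D' := D.withSemigroup e
  let z' := D'.forwardMap z₀ P Z R
  let r' := D'.backwardMap T (z' T) P Z R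
  have z'_cont : ContinuousOn z' (Icc 0 T) := continuousOn_forwardMap (D := D') he.apply hT hP.apply
    (integrable hZ) (integrable hR) z₀
  have r'_cont : ContinuousOn r' (Icc 0 T) := continuousOn_backwardMap (D := D') he.adjoint_apply
    hT hP.apply (integrable hZ) (integrable hR) (z' T)
  have z_tendsto : ∀ t ∈ Icc 0 T, ∀ y,
      Tendsto (fun n => inner ℝ (z n t) y) atTop (𝓝 (inner ℝ (z' t) y)) := fun t ht y =>
    (tendsto_inner_forwardMap hE hP hZ hR ht y).congr fun n => by
      rw [(h n).z_eq t ht, forwardMap]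
  have r_tendsto : ∀ t ∈ Icc 0 T, ∀ y,
      Tendsto (fun n => inner ℝ (r n t) y) atTop (𝓝 (inner ℝ (r' t) y)) := fun t ht y =>
    (tendsto_inner_backwardMap hE hP hZ hR hC (z_tendsto T right_mem) ht y).congr fun n => by
      rw [(h n).r_eq t ht, backwardMap]
  have Z_eq := hZ.ae_eq_of_tendsto_inner z'_cont z_tendsto
  have R_eq := hR.ae_eq_of_tendsto_inner r'_cont r_tendsto
  exact ⟨z', r', z'_cont, r'_cont, fun t ht => forwardMap_congr (D := D') Z_eq R_eq ht,
    fun t ht => backwardMap_congr (D := D') Z_eq R_eq (z' T) ht⟩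

theorem IsMildForwardBackward.exists_of_tendstoStrongStar
    (h : ∀ n, (D.withSemigroup (E n)).IsMildForwardBackward T z₀ P (z n) (r n)) (hT : 0 ≤ T)
    (hE : TendstoStrongStar (Icc 0 T) E e) (hP : StarStronglyContinuous P) {C C' : ℝ}
    (hz : ∀ n, ∀ t ∈ Icc 0 T, ‖z n t‖ ≤ C) (hr : ∀ n, ∀ t ∈ Icc 0 T, ‖r n t‖ ≤ C') :
    ∃ z r, (D.withSemigroup e).IsMildForwardBackward T z₀ P z r := by
  have measurable : ∀ {u : ℝ → H}, ContinuousOn u (Icc 0 T) →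
      AEStronglyMeasurable u (volume.restrict (Ioc 0 T)) := fun hu =>
    (hu.mono Ioc_subset_Icc_self).aestronglyMeasurable measurableSet_Ioc
  have bound : ∀ {u : ℝ → H} {M : ℝ}, (∀ t ∈ Icc 0 T, ‖u t‖ ≤ M) →
      ∀ᵐ t ∂(volume.restrict (Ioc 0 T)), ‖u t‖ ≤ M := fun hu =>
    ae_restrict_of_forall_mem measurableSet_Ioc fun t ht => hu t (Ioc_subset_Icc_self ht)
  obtain ⟨φ, hφ, Z, hZ⟩ := exists_subseq_weaklyConverges
    (fun n => measurable (h n).continuousOn_z) fun n => bound (hz n)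
  obtain ⟨ψ, hψ, R, hR⟩ := exists_subseq_weaklyConverges
    (fun n => measurable (h (φ n)).continuousOn_r) fun n => bound (hr (φ n))
  exact exists_of_weaklyConverges (fun n => h (φ (ψ n))) hT (hE.subseq (hφ.comp hψ)) hP
    (hZ.subseq hψ) hR fun n => hz _ T ⟨hT, le_rfl⟩

end WeakLimit

lemma IsMildForwardBackward.of_withSemigroup {e : ℝ → H →L[ℝ] H} {z r : ℝ → H}
    (h : (D.withSemigroup e).IsMildForwardBackward T z₀ P z r)
    (he : ∀ t, 0 ≤ t → e t = D.expA t) : D.IsMildForwardBackward T z₀ P z r where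
  continuousOn_z := h.continuousOn_z
  continuousOn_r := h.continuousOn_r
  z_eq t ht := by
    have integral_eq : ∀ v : ℝ → H, ∫ s in (0 : ℝ)..t, e (t - s) (v s)
        = ∫ s in (0 : ℝ)..t, D.expA (t - s) (v s) := fun v =>
      intervalIntegral.integral_congr fun s hs => by
        rw [uIcc_of_le ht.1] at hs
        simp only [he _ (sub_nonneg.2 hs.2)]
    refine (h.z_eq t ht).trans ?_
    simp only [withSemigroup, integral_eq, he t ht.1]
    rfl
  r_eq t ht := by
    have integral_eq : ∀ v : ℝ → H, ∫ s in t..T, ((e (s - t))†) (v s)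
        = ∫ s in t..T, D.expAdj (s - t) (v s) := fun v =>
      intervalIntegral.integral_congr fun s hs => by
        rw [uIcc_of_le ht.2] at hs
        simp only [he _ (sub_nonneg.2 hs.1), expAdj]
    refine (h.r_eq t ht).trans ?_
    simp only [withSemigroup, expAdj, integral_eq, he _ (sub_nonneg.2 ht.2)]
    rfl

lemma Standing.eventually_tendstoStrongStar_exp_yosida (hD : D.Standing) (T : ℝ) :
    ∀ᶠ N : ℕ in atTop, TendstoStrongStar (Icc 0 T)
      (fun n t => NormedSpace.exp (t • yosida D.A (n + N))) fun t => D.expA (max t 0) := by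
  obtain ⟨c, hc⟩ := hD.generator.exists_eventually_norm_exp_yosida_le hD.semigroup T
  filter_upwards [eventually_forall_ge_atTop.2 hc] with N hN
  refine ⟨fun n => ⟨stronglyContinuous_exp_smul _, ?_⟩,
    hD.isSemigroupFamily.toStarStronglyContinuous, ⟨c, fun n => hN _ (Nat.le_add_left N n)⟩,
    fun t ht x => ?_, fun t ht x => ?_⟩
  · simpa only [adjoint_exp_smul] using stronglyContinuous_exp_smul ((yosida D.A (n + N))†)
  · rw [max_eq_left ht.1]
    exact (hD.generator.tendsto_exp_yosida hD.semigroup ht.1 x).comp (tendsto_add_atTop_nat N)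
  · rw [max_eq_left ht.1]
    exact (hD.generator.tendsto_adjoint_exp_yosida hD.semigroup ht.1 x).comp
      (tendsto_add_atTop_nat N)

theorem Standing.exists_isMildForwardBackward (hD : D.Standing) (hT : 0 ≤ T)
    (hP : StronglyContinuous P) (hP' : ∀ t, IsSelfAdjoint (P t))
    (hη : D.YosidaRiccatiSolvable T P) (z₀ : H) : ∃ z r, D.IsMildForwardBackward T z₀ P z r := by
  obtain ⟨N₀, C, solvable⟩ := hη
  obtain ⟨N, hE, hN⟩ := ((hD.eventually_tendstoStrongStar_exp_yosida T).and
    (eventually_ge_atTop N₀)).exists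
  obtain ⟨c, hc⟩ := hE.exists_norm_le
  obtain ⟨p, -, hp⟩ := hP.exists_norm_le (isCompact_Icc (a := 0) (b := T))
  have P_star : StarStronglyContinuous P :=
    ⟨hP, by simpa only [fun t => (hP' t).adjoint_eq] using hP⟩
  have approx : ∀ n : ℕ, ∃ z r : ℝ → H, _ := fun n => by
    obtain ⟨η, hη, η_le⟩ := solvable (n + N) (hN.trans (Nat.le_add_left N n))
    exact hη.exists_isMildForwardBackward hT hP z₀ (hc n) hp η_le
  choose z r mild bound using approx
  obtain ⟨z', r', limit⟩ := IsMildForwardBackward.exists_of_tendstoStrongStar mild hT hE P_star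
    (fun n t ht => (bound n t ht).1) fun n t ht => (bound n t ht).2
  exact ⟨z', r', limit.of_withSemigroup fun t ht => by rw [max_eq_left ht]⟩

end Coefficients

end Limit

section Cost

variable {H K U : Type*}
  [NormedAddCommGroup H] [InnerProductSpace ℝ H] [CompleteSpace H]
  [NormedAddCommGroup K] [InnerProductSpace ℝ K] [CompleteSpace K]
  [NormedAddCommGroup U] [InnerProductSpace ℝ U] [CompleteSpace U]
  {D : Coefficients H K U} {T : ℝ} {P : ℝ → H →L[ℝ] H} {z r : ℝ → H}

namespace Coefficients

lemma HasIntegrableTrace.integrableOn_runningCost (htr : D.HasIntegrableTrace T P)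
    (hz : ContinuousOn z (Icc 0 T)) (hr : ContinuousOn r (Icc 0 T)) :
    IntegrableOn (fun u => (1 / 2 : ℝ) * operatorTrace (D.diffusionOp (P u))
      - (1 / 2 : ℝ) * inner ℝ (D.BRB (r u)) (r u)
      + (1 / 2 : ℝ) * inner ℝ (D.Qbar (D.S (z u))) (D.S (z u))) (Icc 0 T) := by
  have Sz_cont : ContinuousOn (fun u => D.S (z u)) (Icc 0 T) := D.S.continuous.comp_continuousOn hz
  refine ((htr.2.const_mul _).sub ?_).add ?_
  · exact (continuousOn_const.mul ((D.BRB.continuous.comp_continuousOn hr).inner hr))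
      |>.integrableOn_Icc
  · exact (continuousOn_const.mul ((D.Qbar.continuous.comp_continuousOn Sz_cont).inner Sz_cont))
      |>.integrableOn_Icc

theorem IsMildForwardBackward.exists_isLQMMildSolution {z₀ : H}
    (h : D.IsMildForwardBackward T z₀ P z r) (hT : 0 ≤ T) (hP : D.IsMildRiccati T P)
    (htr : D.HasIntegrableTrace T P) : ∃ s, D.IsLQMMildSolution T z₀ P r z s := by
  have cost_cont := intervalIntegral.continuousOn_primitive_interval_left (a := 0) (b := T)
    (by simpa only [uIcc_of_le hT] using
      htr.integrableOn_runningCost h.continuousOn_z h.continuousOn_r)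
  rw [uIcc_of_le hT] at cost_cont
  exact ⟨_, hP, h, htr, continuousOn_const.add cost_cont, fun t _ => rfl⟩

end Coefficients

end Cost

end LQMFG

theorem theorem3p1_general {H K U : Type*}
    [NormedAddCommGroup H] [InnerProductSpace ℝ H] [CompleteSpace H]
    [NormedAddCommGroup K] [InnerProductSpace ℝ K] [CompleteSpace K]
    [NormedAddCommGroup U] [InnerProductSpace ℝ U] [CompleteSpace U]
    (D : LQMFG.Coefficients H K U) (hD : D.Standing) (T : ℝ) (hT : 0 ≤ T) (z₀ : H)
    (hη : ∀ P : ℝ → H →L[ℝ] H, D.IsMildRiccati T P → D.YosidaRiccatiSolvable T P)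
    (htr : ∀ P : ℝ → H →L[ℝ] H, D.IsMildRiccati T P → D.HasIntegrableTrace T P) :
    ∃ (P : ℝ → H →L[ℝ] H) (r z : ℝ → H) (s : ℝ → ℝ), D.IsLQMMildSolution T z₀ P r z s := by
  obtain ⟨P, P_cont, P_pos, riccati⟩ := hD.exists_isMildRiccati hT
  obtain ⟨z, r, forwardBackward⟩ := hD.exists_isMildForwardBackward hT P_cont
    (fun t => (P_pos t).isSelfAdjoint) (hη P riccati) z₀
  obtain ⟨s, solution⟩ := forwardBackward.exists_isLQMMildSolution hT riccati (htr P riccati)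
  exact ⟨P, r, z, s, solution⟩

theorem theorem3p1 {H K U : Type*}
    [NormedAddCommGroup H] [InnerProductSpace ℝ H] [CompleteSpace H]
    [TopologicalSpace.SeparableSpace H] [MeasurableSpace H] [BorelSpace H]
    [NormedAddCommGroup K] [InnerProductSpace ℝ K] [CompleteSpace K]
    [TopologicalSpace.SeparableSpace K]
    [NormedAddCommGroup U] [InnerProductSpace ℝ U] [CompleteSpace U]
    [TopologicalSpace.SeparableSpace U]
    (D : LQMFG.Coefficients H K U) (hD : D.Standing)
    (T : ℝ) (hT : 0 < T)
    (m₀ : MeasureTheory.Measure H) [MeasureTheory.IsProbabilityMeasure m₀]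
    (hm₀ : MeasureTheory.Integrable (fun x : H => x) m₀)
    (hη : ∀ P : ℝ → H →L[ℝ] H, D.IsMildRiccati T P → D.YosidaRiccatiSolvable T P)
    (htr : ∀ P : ℝ → H →L[ℝ] H, D.IsMildRiccati T P → D.HasIntegrableTrace T P) :
    ∃ (P : ℝ → H →L[ℝ] H) (r z : ℝ → H) (s : ℝ → ℝ),
      D.IsLQMMildSolution T (∫ x, x ∂m₀) P r z s := by
  exact theorem3p1_general D hD T hT.le (∫ x, x ∂m₀) hη htr
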